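/- Let $d\ge 1$, $\beta>0$, and let $U\in C^2(\mathbb R)$ be symmetric with $U(s)\ge A|s|^2-B$ for all $s\in\mathbb R$, for some $A>0$, $B\in\mathbb R$. Write $\|x\|=\sum_i|x_i|$, let $I=\{-d,\dots,d\}\setminus\{0\}$, let $e_1,\dots,e_d$ be the unit vectors, and put $e_{-i}=-e_i$. A site $x\in\mathbb Z^d$ is even (odd) if $\sum_i x_i$ is even (odd); $\mathcal E^d$ is the set of even sites. **Fields.** Let $(\mathbb Z^d)^*$ be the set of directed bonds $b=(x_b,y_b)$ with $x_b,y_b\in\mathbb Z^d$, $\|x_b-y_b\|=1$, and $(\mathcal E^d)^*$ the set of directed bonds $b=(x_b,y_b)$ with $x_b,y_b\in\mathcal E^d$, $\|x_b-y_b\|=2$. Let $\chi$ be the set of $\eta\in\mathbb R^{(\mathbb Z^d)^*}$ with $\eta(b)=-\eta(-b)$ for all $b$ ($-b$ is the reversed bond) and $\sum_{b\in\mathcal A}\eta(b)=0$ for every closed loop $\mathcal A$ of $4$ bonds through $4$ different sites. Let $\chi_{\rm ev}\subset\mathbb R^{(\mathcal E^d)^*}$ be defined in the same way with the closed loops of $n$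 even bonds through $n$ different even sites, $n\in\{3,4\}$. **Gradient Gibbs measures.** Let $(V,V^*,X)$ be $(\mathbb Z^d,(\mathbb Z^d)^*,\chi)$ or $(\mathcal E^d,(\mathcal E^d)^*,\chi_{\rm ev})$. For finite $\Lambda\subset V$ let $\overline{\Lambda^*}$ be the set of bonds of $V^*$ with at least one end point in $\Lambda$. For $\xi\in X$ and $\eta\in\mathbb R^{\overline{\Lambda^*}}$ let $\eta\vee\xi$ be equal to $\eta$ on $\overline{\Lambda^*}$ and to $\xi$ elsewhere, and let $d\eta_{\Lambda,\xi}$ be Lebesgue measure on the affine space $\{\eta\in\mathbb R^{\overline{\Lambda^*}}:\eta\vee\xi\in X\}$. Given functions $E_\Lambda$ on $X$, let $$\mu_{\Lambda,\xi}(d\eta)=\frac1{Z_{\Lambda,\xi}}\,e^{-E_\Lambda(\eta\vee\xi)}\,d\eta_{\Lambda,\xi},$$ with $Z_{\Lambda,\xi}$ the normalization constant, regarded as a measure on $X$ through $\eta\mapsto\eta\vee\xi$. A $\nabla\phi$-Gibbs measure with energy $E=(E_\Lambda)_\Lambda$ is a probability measure $\mu$ on $X$ such that for every finite $\Lambda\subset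 V$ $$\mu\big(\,\cdot\,\big|\,\sigma(\eta(b):b\in V^*\setminus\overline{\Lambda^*})\big)(\xi)=\mu_{\Lambda,\xi}(\cdot)\qquad\text{for }\mu\text{-a.e. }\xi .$$ Let $\mathcal G(H)$ be the set of such $\mu$ on $\chi$ for $E_\Lambda(\eta)=\beta\sum_{b\in\overline{\Lambda^*}}U(\eta(b))$ that satisfy $\mathbb E^\mu[|\eta(b)|^2]<\infty$ for every bond $b$. **Even Hamiltonian.** For finite $\Lambda_{\rm ev}\subset\mathcal E^d$ let $\Lambda=\Lambda_{\rm ev}\cup\{x+e_i:x\in\Lambda_{\rm ev},\,i\in I\}$ be its associated set in $\mathbb Z^d$. For every odd site $x$ and $a=(a_i)_{i\in I}\in\mathbb R^I$ let $$F_x(a)=-\log\int_{\mathbb R}\exp\Big(-2\beta\sum_{i\in I}U(a_i-t)\Big)\,dt ,$$ and for fixed $k\in I$ and $\eta\in\chi_{\rm ev}$ let $$H^{\rm ev}_{\Lambda_{\rm ev}}(\eta)=\sum_{x\in\Lambda,\ x\ \mathrm{odd}}F_x\big((\eta(x+e_k,x+e_i))_{i\in I}\big),\qquad \eta(x+e_k,x+e_k):=0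 .$$ Let $\mathcal G_{\rm ev}(H^{\rm ev})$ be the set of $\nabla\phi$-Gibbs measures on $\chi_{\rm ev}$ with energy $E_{\Lambda_{\rm ev}}=H^{\rm ev}_{\Lambda_{\rm ev}}$ (which already contains $\beta$) that satisfy $\mathbb E[|\eta(b)|^2]<\infty$ for every even bond $b$. **Induced measure.** For $\eta\in\chi$ let $\eta_{\rm ev}(b)=\eta(x_b,m)+\eta(m,y_b)$ for $b\in(\mathcal E^d)^*$, where $m$ is any common nearest neighbour of $x_b$ and $y_b$; this does not depend on $m$. For $\mu\in\mathcal G(H)$ let $\mu^{\rm ev}$ be the restriction of $\mu$ to the $\sigma$-field generated by the $\eta_{\rm ev}(b)$, $b\in(\mathcal E^d)^*$, that is, the law of $\eta_{\rm ev}$ under $\mu$. **Lemma.** For every $k\in I$: if $\mu\in\mathcal G(H)$, then $\mu^{\rm ev}\in\mathcal G_{\rm ev}(H^{\rm ev})$. -/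

import Mathlib

open MeasureTheory

noncomputable section

namespace GradGibbs

/-! ### The lattice, the even lattice and their bonds -/

/-- Sites of `ℤ^d`. -/
abbrev Site (d : ℕ) : Type := Fin d → ℤ

/-- The distance `‖x - y‖ = ∑ |x_i - y_i|`. -/
def l1dist {d : ℕ} (x y : Site d) : ℤ := ∑ i, |x i - y i|

/-- The even sites: the coordinates sum up to an even number. -/
def evenSites (d : ℕ) : Set (Site d) := {x | Even (∑ i, x i)}

/-- The index set `I = {-d, …, d} \ {0}`: a coordinate and a sign. -/
abbrev Dir (d : ℕ) : Type := Fin d × ℤˣ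

/-- The unit vector `e_i`, `i ∈ I`; the vector of `(j, -1)` is minus that of `(j, 1)`. -/
def unitVec {d : ℕ} (i : Dir d) : Site d := Pi.single i.1 (i.2 : ℤ)

theorem l1dist_comm {d : ℕ} (x y : Site d) : l1dist x y = l1dist y x := by
  simp only [l1dist, abs_sub_comm]

theorem l1dist_self {d : ℕ} (x : Site d) : l1dist x x = 0 := by
  simp [l1dist]

/-- The nearest neighbour graph of `ℤ^d`. Its directed bonds `(x_b, y_b)` are
`(latticeGraph d).Dart`, with `x_b = b.fst` and `y_b = b.snd`. -/
def latticeGraph (d : ℕ) : SimpleGraph (Site d) where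
  Adj x y := l1dist x y = 1
  symm := ⟨fun x y h => by rw [l1dist_comm]; exact h⟩
  loopless := ⟨fun x h => by simp [l1dist_self] at h⟩

/-- The graph of the even lattice: bonds join even sites at distance `2`.
(Odd sites carry no bond, so `(evenGraph d).Dart` is the set of directed even bonds.) -/
def evenGraph (d : ℕ) : SimpleGraph (Site d) where
  Adj x y := x ∈ evenSites d ∧ y ∈ evenSites d ∧ l1dist x y = 2
  symm := ⟨fun x y h => ⟨h.2.1, h.1, by rw [l1dist_comm]; exact h.2.2⟩⟩
  loopless := ⟨fun x h => by simp [l1dist_self] at h⟩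

theorem finite_of_l1dist {d : ℕ} (x : Site d) (r : ℤ) : {y : Site d | l1dist x y = r}.Finite := by
  refine (Set.finite_Icc (fun i => x i - r) (fun i => x i + r)).subset ?_
  intro y hy
  have hy' : ∀ i, |x i - y i| ≤ r := fun i => by
    rw [← (show l1dist x y = r from hy)]
    exact Finset.single_le_sum (f := fun i => |x i - y i|) (fun j _ => abs_nonneg _)
      (Finset.mem_univ i)
  refine ⟨fun i => ?_, fun i => ?_⟩
  · have := abs_le.1 (hy' i); simp only; linarith [this.2]
  · have := abs_le.1 (hy' i); simp only; linarith [this.1]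

instance latticeGraph_locallyFinite (d : ℕ) : (latticeGraph d).LocallyFinite := fun x =>
  (finite_of_l1dist x 1).fintype

instance evenGraph_locallyFinite (d : ℕ) : (evenGraph d).LocallyFinite := fun x =>
  ((finite_of_l1dist x 2).subset fun _ h => h.2.2).fintype

/-! ### Gradient fields and gradient Gibbs measures on a graph -/

section Graph

variable {d : ℕ} (G : SimpleGraph (Site d))

/-- The fields `η` of height differences that satisfy the plaquette condition: they are
antisymmetric and sum up to zero along the plaquettes, that is the closed loops through `n`
different points, where `n` ranges over `N` (`N = {4}` on `ℤ^d`, `N = {3, 4}` on the even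
lattice). -/
def plaquetteFields (N : Set ℕ) : Submodule ℝ (G.Dart → ℝ) where
  carrier := {η | (∀ b, η b = -η b.symm) ∧
    ∀ (u : Site d) (p : G.Walk u u), p.IsCycle → p.length ∈ N → (p.darts.map η).sum = 0}
  add_mem' := by
    rintro η ζ ⟨h1, h2⟩ ⟨h3, h4⟩
    refine ⟨fun b => ?_, fun u p hp hN => ?_⟩
    · simp only [Pi.add_apply]; rw [h1 b, h3 b]; ring
    · change (p.darts.map fun b => η b + ζ b).sum = 0
      rw [List.sum_map_add, h2 u p hp hN, h4 u p hp hN, add_zero]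
  zero_mem' := by
    refine ⟨fun b => by simp, fun u p _ _ => ?_⟩
    change (p.darts.map fun _ => (0 : ℝ)).sum = 0
    simp
  smul_mem' := by
    rintro c η ⟨h1, h2⟩
    refine ⟨fun b => ?_, fun u p hp hN => ?_⟩
    · simp only [Pi.smul_apply, smul_eq_mul]; rw [h1 b]; ring
    · change (p.darts.map fun b => c * η b).sum = 0
      rw [List.sum_map_mul_left, h2 u p hp hN, mul_zero]

/-- The bonds with at least one end point in `Λ`. -/
def closedBonds (Λ : Finset (Site d)) : Set G.Dart := {b | b.fst ∈ Λ ∨ b.snd ∈ Λ}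

theorem closedBonds_finite [G.LocallyFinite] (Λ : Finset (Site d)) :
    (closedBonds G Λ).Finite := by
  have hfin : (⋃ x ∈ Λ, (({x} : Set (Site d)) ×ˢ G.neighborSet x ∪
      G.neighborSet x ×ˢ ({x} : Set (Site d)))).Finite := by
    refine Λ.finite_toSet.biUnion fun x _ => ?_
    have : (G.neighborSet x).Finite := Set.toFinite _
    exact ((Set.finite_singleton x).prod this).union (this.prod (Set.finite_singleton x))
  refine Set.Finite.of_finite_image (f := fun b : G.Dart => b.toProd) (hfin.subset ?_)
    (fun a _ b _ h => SimpleGraph.Dart.ext _ _ h)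
  rintro _ ⟨b, hb, rfl⟩
  simp only [Set.mem_iUnion]
  rcases hb with hb | hb
  · exact ⟨b.fst, hb, Or.inl ⟨rfl, b.adj⟩⟩
  · exact ⟨b.snd, hb, Or.inr ⟨b.adj.symm, rfl⟩⟩

instance closedBonds_fintype [G.LocallyFinite] (Λ : Finset (Site d)) :
    Fintype (closedBonds G Λ) := (closedBonds_finite G Λ).fintype

open Classical in
/-- The field `η ∨ ξ`: equal to `η` on the bonds touching `Λ` and to `ξ` elsewhere. -/
def glue (Λ : Finset (Site d)) (η : closedBonds G Λ → ℝ) (ξ : G.Dart → ℝ) : G.Dart → ℝ :=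
  fun b => if h : b ∈ closedBonds G Λ then η ⟨b, h⟩ else ξ b

/-- The space of all configurations on the bonds touching `Λ` that are compatible with the
boundary condition `ξ`. -/
def compatible (N : Set ℕ) (Λ : Finset (Site d)) (ξ : G.Dart → ℝ) :
    Set (EuclideanSpace ℝ (closedBonds G Λ)) :=
  {η | glue G Λ η.ofLp ξ ∈ plaquetteFields G N}

/-- The direction space of the affine space `compatible G N Λ ξ`
(see `mem_compatible_iff`). -/
def directions (N : Set ℕ) (Λ : Finset (Site d)) :
    Submodule ℝ (EuclideanSpace ℝ (closedBonds G Λ)) where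
  carrier := {v | glue G Λ v.ofLp 0 ∈ plaquetteFields G N}
  add_mem' := by
    intro v w hv hw
    have : glue G Λ (v + w).ofLp 0 = glue G Λ v.ofLp 0 + glue G Λ w.ofLp 0 := by
      funext b; by_cases h : b ∈ closedBonds G Λ <;> simp [glue, h]
    simp only [Set.mem_ofPred_eq] at *
    rw [this]; exact Submodule.add_mem _ hv hw
  zero_mem' := by
    have : glue G Λ (0 : EuclideanSpace ℝ (closedBonds G Λ)).ofLp 0 = 0 := by
      funext b; by_cases h : b ∈ closedBonds G Λ <;> simp [glue, h]
    simp only [Set.mem_ofPred_eq]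
    rw [this]; exact Submodule.zero_mem _
  smul_mem' := by
    intro c v hv
    have : glue G Λ (c • v).ofLp 0 = c • glue G Λ v.ofLp 0 := by
      funext b; by_cases h : b ∈ closedBonds G Λ <;> simp [glue, h]
    simp only [Set.mem_ofPred_eq] at *
    rw [this]; exact Submodule.smul_mem _ c hv

/-- The point `ξ + v` of the affine space through the restriction of `ξ`, extended by `ξ`. -/
def shift (N : Set ℕ) (Λ : Finset (Site d)) (ξ : G.Dart → ℝ) (v : directions G N Λ) :
    G.Dart → ℝ :=
  glue G Λ (fun b => ξ b + v.1.ofLp b) ξ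

theorem mem_compatible_iff (N : Set ℕ) (Λ : Finset (Site d)) {ξ : G.Dart → ℝ}
    (hξ : ξ ∈ plaquetteFields G N) (η : EuclideanSpace ℝ (closedBonds G Λ)) :
    η ∈ compatible G N Λ ξ ↔
      ∃ v : directions G N Λ, η = WithLp.toLp 2 (fun b : closedBonds G Λ => ξ b) + v := by
  have key : ∀ w : EuclideanSpace ℝ (closedBonds G Λ),
      glue G Λ (WithLp.toLp 2 (fun b : closedBonds G Λ => ξ b) + w).ofLp ξ
        = ξ + glue G Λ w.ofLp 0 := by
    intro w; funext b; by_cases h : b ∈ closedBonds G Λ <;> simp [glue, h]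
  constructor
  · intro h
    refine ⟨⟨η - WithLp.toLp 2 (fun b : closedBonds G Λ => ξ b), ?_⟩, by simp⟩
    have h' := key (η - WithLp.toLp 2 (fun b : closedBonds G Λ => ξ b))
    rw [add_sub_cancel] at h'
    change glue G Λ _ 0 ∈ plaquetteFields G N
    have h2 : glue G Λ η.ofLp ξ ∈ plaquetteFields G N := h
    rw [h'] at h2
    exact (Submodule.add_mem_iff_right _ hξ).1 h2
  · rintro ⟨v, rfl⟩
    change glue G Λ _ ξ ∈ plaquetteFields G N
    rw [key]
    exact Submodule.add_mem _ hξ v.2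

variable [G.LocallyFinite]

/-- Lebesgue measure `dη_{Λ,ξ}` on the affine space `compatible G N Λ ξ`, seen as a measure on
the fields on all bonds through `η ↦ η ∨ ξ`. Lebesgue measure on the direction space is the one
of a Euclidean space (an orthonormal basis spans a cube of volume one). -/
def lebesgue (N : Set ℕ) (Λ : Finset (Site d)) (ξ : G.Dart → ℝ) : Measure (G.Dart → ℝ) :=
  ((stdOrthonormalBasis ℝ (directions G N Λ)).toBasis.addHaar).map (shift G N Λ ξ)

/-- The density `exp (-E_Λ(η ∨ ξ))` with respect to `dη_{Λ,ξ}`, not normalized. -/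
def unnormalized (N : Set ℕ) (E : Finset (Site d) → (G.Dart → ℝ) → ℝ) (Λ : Finset (Site d))
    (ξ : G.Dart → ℝ) : Measure (G.Dart → ℝ) :=
  (lebesgue G N Λ ξ).withDensity fun η => ENNReal.ofReal (Real.exp (-E Λ η))

/-- The finite volume gradient Gibbs measure with energy `E` (the inverse temperature is
contained in `E`) and boundary condition `ξ`. -/
def finiteVolume (N : Set ℕ) (E : Finset (Site d) → (G.Dart → ℝ) → ℝ) (Λ : Finset (Site d))
    (ξ : G.Dart → ℝ) : Measure (G.Dart → ℝ) :=
  (unnormalized G N E Λ ξ Set.univ)⁻¹ • unnormalized G N E Λ ξ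

/-- The σ-field generated by `η(b)` for the bonds `b` that do not touch `Λ`. -/
@[reducible] def outsideField (Λ : Finset (Site d)) : MeasurableSpace (G.Dart → ℝ) :=
  ⨆ b ∈ (closedBonds G Λ)ᶜ, MeasurableSpace.comap (fun η : G.Dart → ℝ => η b) inferInstance

/-- `μ` is a gradient Gibbs measure: a probability measure carried by the plaquette fields that
satisfies the DLR equation for every finite set `Λ` of sites (`S` is the set of all sites). -/
structure IsGradGibbs (S : Set (Site d)) (N : Set ℕ) (E : Finset (Site d) → (G.Dart → ℝ) → ℝ)
    (μ : Measure (G.Dart → ℝ)) : Prop where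
  prob : IsProbabilityMeasure μ
  carried : ∀ᵐ η ∂μ, η ∈ plaquetteFields G N
  dlr : ∀ Λ : Finset (Site d), (Λ : Set (Site d)) ⊆ S → ∀ A : Set (G.Dart → ℝ), MeasurableSet A →
    μ[A.indicator (fun _ => (1 : ℝ)) | outsideField G Λ]
      =ᵐ[μ] fun ξ => (finiteVolume G N E Λ ξ).real A

/-- The gradient Gibbs measures with finite second moments. -/
def gibbsClass (S : Set (Site d)) (N : Set ℕ) (E : Finset (Site d) → (G.Dart → ℝ) → ℝ) :
    Set (Measure (G.Dart → ℝ)) :=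
  {μ | IsGradGibbs G S N E μ ∧ ∀ b : G.Dart, Integrable (fun η => η b ^ 2) μ}

end Graph

/-! ### The two Hamiltonians -/

section Models

variable {d : ℕ}

/-- `β` times the sum of `U(η(b))` over the directed bonds touching `Λ`. -/
def pairEnergy (β : ℝ) (U : ℝ → ℝ) (Λ : Finset (Site d)) (η : (latticeGraph d).Dart → ℝ) : ℝ :=
  β * ∑ b : closedBonds (latticeGraph d) Λ, U (η b)

/-- `F((a_i)_{i ∈ I}) = -log ∫ exp(-2β ∑_i U(a_i - t)) dt`; for a site `x` it is evaluated at
`a_i = φ(x + e_i)`, and `t` stands for the height `φ(x)` that is integrated out. -/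
def oddPotential (β : ℝ) (U : ℝ → ℝ) (a : Dir d → ℝ) : ℝ :=
  -Real.log (∫ t : ℝ, Real.exp (-(2 * β * ∑ i, U (a i - t))))

/-- The finite set in `ℤ^d` associated to a finite set of even sites: its points and all their
nearest neighbours. -/
def assocSet (Λ : Finset (Site d)) : Finset (Site d) :=
  Λ ∪ Λ.biUnion fun x => Finset.univ.image fun i : Dir d => x + unitVec i

open Classical in
/-- `η(u, v)` as a function of the end points of an even bond; zero if `(u, v)` is not an even
bond, in particular for `u = v`. -/
def evenValue (η : (evenGraph d).Dart → ℝ) (u v : Site d) : ℝ :=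
  if h : (evenGraph d).Adj u v then η ⟨(u, v), h⟩ else 0

/-- The even Hamiltonian: the sum over the odd sites `x` of the associated set of
`F_x((η(x + e_k, x + e_i))_{i ∈ I})`. -/
def evenEnergy (β : ℝ) (U : ℝ → ℝ) (k : Dir d) (Λ : Finset (Site d))
    (η : (evenGraph d).Dart → ℝ) : ℝ :=
  ∑ x ∈ (assocSet Λ).filter (fun x => Odd (∑ i, x i)),
    oddPotential β U fun i => evenValue η (x + unitVec k) (x + unitVec i)

/-! ### The field on the even bonds -/

/-- The two end points of an even bond have a common nearest neighbour. -/
theorem exists_mid (b : (evenGraph d).Dart) :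
    ∃ m, (latticeGraph d).Adj b.fst m ∧ (latticeGraph d).Adj m b.snd := by
  have h2 : l1dist b.fst b.snd = 2 := b.adj.2.2
  obtain ⟨i, hi⟩ : ∃ i, b.fst i ≠ b.snd i := by
    by_contra! h
    have : l1dist b.fst b.snd = 0 := by simp [l1dist, h]
    omega
  obtain ⟨c, hc1, hc2⟩ : ∃ c : ℤ, |b.fst i - c| = 1 ∧ |c - b.snd i| = |b.fst i - b.snd i| - 1 := by
    rcases lt_or_gt_of_ne hi with h | h
    · refine ⟨b.fst i + 1, by simp, ?_⟩
      rw [abs_of_nonpos (by omega), abs_of_neg (by omega)]; ring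
    · refine ⟨b.fst i - 1, by simp, ?_⟩
      rw [abs_of_nonneg (by omega), abs_of_pos (by omega)]; ring
  refine ⟨Function.update b.fst i c, ?_, ?_⟩
  · change l1dist _ _ = 1
    rw [l1dist, Finset.sum_eq_single i (fun j _ hj => by simp [hj]) (by simp)]
    simpa using hc1
  · change l1dist _ _ = 1
    rw [l1dist, ← Finset.add_sum_erase _ _ (Finset.mem_univ i)] at h2 ⊢
    rw [Finset.sum_congr rfl (g := fun j => |b.fst j - b.snd j|) (fun j hj => by
      rw [Function.update_of_ne (Finset.ne_of_mem_erase hj)])]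
    simp only [Function.update_self]
    omega

/-- The induced field on the even bonds: `η_ev(b) = η(x_b, m) + η(m, y_b)` for a common nearest
neighbour `m` of the end points. On plaquette fields it does not depend on the choice of `m`,
see `evenField_eq`. -/
def evenField (η : (latticeGraph d).Dart → ℝ) : (evenGraph d).Dart → ℝ := fun b =>
  η ⟨(b.fst, (exists_mid b).choose), (exists_mid b).choose_spec.1⟩ +
    η ⟨((exists_mid b).choose, b.snd), (exists_mid b).choose_spec.2⟩

theorem evenField_eq {η : (latticeGraph d).Dart → ℝ}
    (hη : η ∈ plaquetteFields (latticeGraph d) {4}) (b : (evenGraph d).Dart) (x : Site d)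
    (h1 : (latticeGraph d).Adj b.fst x) (h2 : (latticeGraph d).Adj x b.snd) :
    evenField η b = η ⟨(b.fst, x), h1⟩ + η ⟨(x, b.snd), h2⟩ := by
  have hne : b.fst ≠ b.snd := b.adj.ne
  suffices H : ∀ (m : Site d) (hm1 : (latticeGraph d).Adj b.fst m)
      (hm2 : (latticeGraph d).Adj m b.snd),
      η ⟨(b.fst, m), hm1⟩ + η ⟨(m, b.snd), hm2⟩ = η ⟨(b.fst, x), h1⟩ + η ⟨(x, b.snd), h2⟩ from
    H _ _ _
  intro m hm1 hm2
  rcases eq_or_ne x m with rfl | hxm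
  · rfl
  have hcyc := hη.2 b.fst (.cons h1 (.cons h2 (.cons hm2.symm (.cons hm1.symm .nil)))) (by
    have := h1.ne; have := h2.ne; have := hm1.ne; have := hm2.ne
    rw [SimpleGraph.Walk.cons_isCycle_iff]
    refine ⟨?_, ?_⟩
    · simp [SimpleGraph.Walk.isPath_def]; grind
    · simp; grind) (by simp)
  have e1 := hη.1 ⟨(m, b.snd), hm2⟩
  have e2 := hη.1 ⟨(b.fst, m), hm1⟩
  simp [SimpleGraph.Dart.symm] at hcyc e1 e2
  linarith

theorem measurable_evenField : Measurable (evenField (d := d)) :=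
  measurable_pi_lambda _ fun _ => (measurable_pi_apply _).add (measurable_pi_apply _)

end Models

end GradGibbs

end

noncomputable section

namespace GradGibbs

/-! ### Nearest neighbours and parity -/

section Lattice

variable {d : ℕ}

/-! Fix a finite set `Λ` of even sites. A bond touching the associated set has exactly one odd end
point, and that end point lies in the set. Hence `H` is a sum over the odd sites `x` of functions of
the differences between `x` and its neighbours (`pairEnergy_eq_sum`). With the even heights frozen,
the odd heights decouple, and integrating them out produces the factors `exp (-F_x)`
(`lintegral_boltzmann_oddHeight`).

To turn this into a DLR equation no change of variables in Lebesgue measure is made. Call a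
plaquette field that vanishes off the bonds touching a set a direction of that set. The DLR equation
for `μ` says that `exp(H) μ` is invariant under translation by directions of the associated set
(`IsGradGibbs.lintegral_add_extend`). The linear map `fiberField` sends a pair (even direction of
`Λ`, heights on the odd sites) to such a direction, whose induced even field is the given one.
Averaging over its orbits (`lintegral_mul_lintegral_orbit`) gives `∫ g ∫ b f = ∫ g f ∫ b` for
orbit-invariant `g`, with `b` the Boltzmann factor. Neither a Jacobian nor surjectivity of
`fiberField` enters. By Fubini the inner integrals are those of the even model
(`lintegral_boltzmann_fiberField`). Taking `g = 1_s / Z_ev`, with `s` determined outside `Λ`, yields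
the DLR equation integrated over `s`; the division is legitimate because `Z_ev` is positive and, by
the growth of `U`, finite.

Two further points: the induced field satisfies the even plaquette condition because a plaquette
field on `ℤ^d` has a global potential (`exists_potential`), and the finite volume kernel is a.e.
measurable with respect to the outside field thanks to `exists_outside_section`. -/

theorem even_l1dist_iff (x y : Site d) :
    Even (l1dist x y) ↔ (Even (∑ i, x i) ↔ Even (∑ i, y i)) := by
  have h : ∀ s : Finset (Fin d),
      Even (∑ i ∈ s, |x i - y i|) ↔ (Even (∑ i ∈ s, x i) ↔ Even (∑ i ∈ s, y i)) := by
    intro s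
    induction s using Finset.induction_on with
    | empty => simp
    | insert a s ha ih =>
      rw [Finset.sum_insert ha, Finset.sum_insert ha, Finset.sum_insert ha, Int.even_add,
        Int.even_add, Int.even_add, ih, even_abs, Int.even_sub]
      tauto
  exact h _

theorem l1dist_triangle (x y z : Site d) : l1dist x z ≤ l1dist x y + l1dist y z := by
  rw [l1dist, l1dist, l1dist, ← Finset.sum_add_distrib]
  exact Finset.sum_le_sum fun i _ => abs_sub_le _ _ _

theorem eq_of_l1dist_eq_zero {x y : Site d} (h : l1dist x y = 0) : x = y := by
  funext i
  have := (Finset.sum_eq_zero_iff_of_nonneg (fun i _ => abs_nonneg (x i - y i))).1 h i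
    (Finset.mem_univ i)
  exact sub_eq_zero.1 (abs_eq_zero.1 this)

theorem l1dist_nonneg (x y : Site d) : 0 ≤ l1dist x y :=
  Finset.sum_nonneg fun _ _ => abs_nonneg _

theorem latticeGraph_adj_parity {x y : Site d} (h : (latticeGraph d).Adj x y) :
    Odd (∑ i, x i) ↔ ¬ Odd (∑ i, y i) := by
  have h1 : l1dist x y = 1 := h
  have h2 := even_l1dist_iff x y
  rw [h1] at h2
  simp only [← Int.not_even_iff_odd]
  have : ¬ Even (1 : ℤ) := by decide
  tauto

theorem adj_add_unitVec (x : Site d) (i : Dir d) : (latticeGraph d).Adj x (x + unitVec i) := by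
  change l1dist _ _ = 1
  have : ∀ j, |x j - (x + unitVec i) j| = if j = i.1 then 1 else 0 := by
    intro j
    by_cases h : j = i.1
    · subst h
      rcases Int.units_eq_one_or i.2 with h | h <;> simp [unitVec, h]
    · simp [unitVec, h]
  rw [l1dist, Finset.sum_congr rfl fun j _ => this j]
  simp

theorem exists_unitVec_of_adj {x y : Site d} (h : (latticeGraph d).Adj x y) :
    ∃ i : Dir d, y = x + unitVec i := by
  have h1 : l1dist x y = 1 := h
  obtain ⟨i, hi⟩ : ∃ i, x i ≠ y i := by
    by_contra! h0
    have : l1dist x y = 0 := by simp [l1dist, h0]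
    omega
  rw [l1dist, ← Finset.add_sum_erase _ _ (Finset.mem_univ i)] at h1
  have hpos : 0 < |x i - y i| := abs_pos.2 (sub_ne_zero.2 hi)
  have hnn : 0 ≤ ∑ j ∈ Finset.univ.erase i, |x j - y j| :=
    Finset.sum_nonneg fun _ _ => abs_nonneg _
  have hz : ∑ j ∈ Finset.univ.erase i, |x j - y j| = 0 := by omega
  have hz' := (Finset.sum_eq_zero_iff_of_nonneg (fun j _ => abs_nonneg (x j - y j))).1 hz
  have hone : |y i - x i| = 1 := by rw [abs_sub_comm]; omega
  have hoff : ∀ j, j ≠ i → y j = x j := fun j hj => by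
    have := hz' j (Finset.mem_erase.2 ⟨hj, Finset.mem_univ j⟩)
    exact (sub_eq_zero.1 (abs_eq_zero.1 this)).symm
  rcases (abs_eq (by norm_num)).1 hone with h2 | h2
  · refine ⟨(i, 1), funext fun j => ?_⟩
    by_cases hj : j = i
    · subst hj; simp [unitVec]; omega
    · simp [unitVec, hj, hoff j hj]
  · refine ⟨(i, -1), funext fun j => ?_⟩
    by_cases hj : j = i
    · subst hj; simp [unitVec]; omega
    · simp [unitVec, hj, hoff j hj]

theorem unitVec_injective : Function.Injective (unitVec (d := d)) := by
  rintro ⟨i, s⟩ ⟨j, t⟩ h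
  have h1 := congrFun h i
  by_cases hij : i = j
  · subst hij
    simp only [unitVec, Pi.single_eq_same] at h1
    rw [Units.ext h1]
  · simp [unitVec, hij] at h1

/-- Distinct neighbours of an odd site are joined by an even bond. -/
theorem evenGraph_adj_of_adj {m x y : Site d} (hm : Odd (∑ i, m i))
    (hx : (latticeGraph d).Adj m x) (hy : (latticeGraph d).Adj m y) (hxy : x ≠ y) :
    (evenGraph d).Adj x y := by
  have ex : Even (∑ i, x i) := Int.not_odd_iff_even.1 ((latticeGraph_adj_parity hx).1 hm)
  have ey : Even (∑ i, y i) := Int.not_odd_iff_even.1 ((latticeGraph_adj_parity hy).1 hm)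
  refine ⟨ex, ey, ?_⟩
  have h1 : l1dist m x = 1 := hx
  have h2 : l1dist m y = 1 := hy
  have h3 := l1dist_triangle x m y
  rw [l1dist_comm x m, h1, h2] at h3
  have h4 : l1dist x y ≠ 0 := fun h => hxy (eq_of_l1dist_eq_zero h)
  have h5 : Even (l1dist x y) := (even_l1dist_iff x y).2 (by tauto)
  have h6 := l1dist_nonneg x y
  obtain ⟨r, hr⟩ := h5
  omega

end Lattice

/-! ### Gradients -/

section Gradient

variable {d : ℕ}

/-- The gradient of a height function. -/
def grad (G : SimpleGraph (Site d)) (φ : Site d → ℝ) : G.Dart → ℝ := fun b => φ b.snd - φ b.fst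

theorem sum_grad_darts (G : SimpleGraph (Site d)) (φ : Site d → ℝ) {u v : Site d}
    (p : G.Walk u v) : (p.darts.map (grad G φ)).sum = φ v - φ u := by
  induction p with
  | nil => simp
  | cons h p ih => simp [ih, grad]

theorem grad_mem_plaquetteFields (G : SimpleGraph (Site d)) (N : Set ℕ) (φ : Site d → ℝ) :
    grad G φ ∈ plaquetteFields G N :=
  ⟨fun b => by simp [grad], fun u p _ _ => by rw [sum_grad_darts, sub_self]⟩

/-- A discrete antiderivative on `ℤ`. -/
theorem exists_antidifference (g : ℤ → ℝ) : ∃ G : ℤ → ℝ, ∀ n, G (n + 1) = G n + g n := by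
  -- The signed sum from `0` to `n`; one of the two intervals is always empty.
  refine ⟨fun n => ∑ j ∈ Finset.Ico 0 n, g j - ∑ j ∈ Finset.Ico n 0, g j, fun n => ?_⟩
  rcases le_or_gt 0 n with h | h
  · have e : Finset.Ico 0 (n + 1) = insert n (Finset.Ico 0 n) := by
      ext; simp; omega
    have e2 : Finset.Ico (n + 1) 0 = ∅ := by ext; simp; omega
    have e3 : Finset.Ico n 0 = ∅ := by ext; simp; omega
    simp [e, e2, e3]; ring
  · have e : Finset.Ico n 0 = insert n (Finset.Ico (n + 1) 0) := by
      ext; simp; omega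
    have e2 : Finset.Ico 0 (n + 1) = ∅ := by ext; simp; omega
    have e3 : Finset.Ico 0 n = ∅ := by ext; simp; omega
    simp [e, e2, e3]

/-- Poincaré's lemma on `ℤ^d`: a closed one-form is exact. -/
theorem exists_potential (h : Site d → Fin d → ℝ)
    (hcl : ∀ x i j, i ≠ j →
      h x i + h (x + Pi.single i 1) j = h x j + h (x + Pi.single j 1) i) :
    ∃ φ : Site d → ℝ, ∀ x i, φ (x + Pi.single i 1) - φ x = h x i := by
  suffices H : ∀ s : Finset (Fin d), ∃ φ : Site d → ℝ,
      ∀ x, ∀ i ∈ s, φ (x + Pi.single i 1) - φ x = h x i by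
    obtain ⟨φ, hφ⟩ := H Finset.univ
    exact ⟨φ, fun x i => hφ x i (Finset.mem_univ i)⟩
  intro s
  induction s using Finset.induction_on with
  | empty => exact ⟨0, by simp⟩
  | insert j s hj ih =>
    obtain ⟨φ, hφ⟩ := ih
    choose S hS using exists_antidifference
    -- The defect of `φ` in the new direction `j`. Closedness makes it invariant under the steps in
    -- `s`, so summing it along the `j`-lines corrects direction `j` without spoiling those in `s`.
    let r : Site d → ℝ := fun x => h x j - (φ (x + Pi.single j 1) - φ x)
    have hr : ∀ x, ∀ i ∈ s, r (x + Pi.single i 1) = r x := by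
      intro x i hi
      have hij : i ≠ j := fun e => hj (e ▸ hi)
      have h1 := hcl x i j hij
      have h2 := hφ x i hi
      have h3 := hφ (x + Pi.single j 1) i hi
      simp only [r]
      rw [add_right_comm x (Pi.single i 1) (Pi.single j 1)]
      linarith
    refine ⟨fun x => φ x + S (fun t => r (Function.update x j t)) (x j), fun x i hi => ?_⟩
    rcases Finset.mem_insert.1 hi with rfl | hi
    · have e : (fun t => r (Function.update (x + Pi.single i 1) i t)) =
          fun t => r (Function.update x i t) := by
        funext t; congr 1; funext l
        by_cases hl : l = i
        · subst hl; simp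
        · simp [hl]
      simp only [e, Pi.add_apply, Pi.single_eq_same]
      rw [hS, Function.update_eq_self]
      simp only [r]; ring
    · have hij : i ≠ j := fun e => hj (e ▸ hi)
      have e : (fun t => r (Function.update (x + Pi.single i 1) j t)) =
          fun t => r (Function.update x j t) := by
        funext t
        rw [← hr (Function.update x j t) i hi]
        congr 1; funext l
        by_cases hl : l = j
        · subst hl; simp [hij.symm]
        · simp [hl]
      simp only [e, Pi.add_apply, Pi.single_eq_of_ne hij.symm, add_zero]
      rw [← hφ x i hi]; ring

theorem exists_grad_eq {η : (latticeGraph d).Dart → ℝ}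
    (hη : η ∈ plaquetteFields (latticeGraph d) {4}) :
    ∃ φ : Site d → ℝ, η = grad (latticeGraph d) φ := by
  have hadj : ∀ (x : Site d) (i : Fin d), (latticeGraph d).Adj x (x + Pi.single i 1) :=
    fun x i => by simpa [unitVec] using adj_add_unitVec x (i, 1)
  obtain ⟨φ, hφ⟩ := exists_potential (fun x i => η ⟨(x, x + Pi.single i 1), hadj x i⟩) (by
    intro x i j hij
    have a1 := hadj x i
    have a2 := hadj (x + Pi.single i 1) j
    have a3 := hadj x j
    have a4 := hadj (x + Pi.single j 1) i
    have e : x + Pi.single j 1 + Pi.single i 1 = x + Pi.single i 1 + Pi.single j 1 :=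
      add_right_comm _ _ _
    -- The far corner is a free `z` because the two paths reach it as `x + e_i + e_j` and as `x +
    -- e_j + e_i`.
    have key : ∀ (z : Site d) (h2 : (latticeGraph d).Adj (x + Pi.single i 1) z)
        (h4 : (latticeGraph d).Adj (x + Pi.single j 1) z), x ≠ z →
        η ⟨(x, x + Pi.single i 1), a1⟩ + η ⟨(x + Pi.single i 1, z), h2⟩ =
        η ⟨(x, x + Pi.single j 1), a3⟩ + η ⟨(x + Pi.single j 1, z), h4⟩ := by
      intro z h2 h4 hxz
      have hne : x + Pi.single i 1 ≠ x + Pi.single j 1 := by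
        intro h0
        have := congrFun (add_left_cancel h0) i
        simp [hij] at this
      have hcyc := hη.2 x (.cons a1 (.cons h2 (.cons h4.symm (.cons a3.symm .nil)))) (by
        have := a1.ne; have := h2.ne; have := h4.ne; have := a3.ne
        rw [SimpleGraph.Walk.cons_isCycle_iff]
        refine ⟨?_, ?_⟩
        · simp only [SimpleGraph.Walk.isPath_def]; simp; grind
        · simp; grind) (by simp)
      have e1 := hη.1 ⟨(x + Pi.single j 1, z), h4⟩
      have e2 := hη.1 ⟨(x, x + Pi.single j 1), a3⟩
      simp [SimpleGraph.Dart.symm] at hcyc e1 e2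
      linarith
    have := key _ a2 (e ▸ a4) (by
      intro h0
      have := congrFun h0 i
      simp [hij] at this)
    rw [this]
    simp only [e])
  refine ⟨φ, funext fun b => ?_⟩
  obtain ⟨⟨x, y⟩, hb⟩ := b
  obtain ⟨⟨i, s⟩, hy⟩ := exists_unitVec_of_adj (x := x) (y := y) hb
  subst hy
  rcases Int.units_eq_one_or s with rfl | rfl
  · simp only [grad]
    simpa [unitVec] using (hφ x i).symm
  · have h0 := hφ (x + unitVec (i, -1)) i
    have e : x + unitVec (i, -1) + Pi.single i 1 = x := by
      funext l; by_cases hl : l = i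
      · subst hl; simp [unitVec]
      · simp [unitVec, hl]
    simp only [e] at h0
    rw [hη.1]
    simp only [grad, SimpleGraph.Dart.symm, Prod.swap] at h0 ⊢
    linarith

theorem evenField_grad (φ : Site d → ℝ) :
    evenField (grad (latticeGraph d) φ) = grad (evenGraph d) φ := by
  funext b
  simp [evenField, grad]

/-- Both fields are gradients of one height function, so sums along any even loop telescope. -/
theorem evenField_mem_plaquetteFields {η : (latticeGraph d).Dart → ℝ}
    (hη : η ∈ plaquetteFields (latticeGraph d) {4}) (N : Set ℕ) :
    evenField η ∈ plaquetteFields (evenGraph d) N := by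
  obtain ⟨φ, rfl⟩ := exists_grad_eq hη
  rw [evenField_grad]
  exact grad_mem_plaquetteFields _ _ _

end Gradient

/-! ### Lifting even fields to the lattice -/

section Lift

variable {d : ℕ}

theorem evenValue_self (v : (evenGraph d).Dart → ℝ) (x : Site d) : evenValue v x x = 0 := by
  simp [evenValue]

theorem evenValue_of_adj (v : (evenGraph d).Dart → ℝ) {x y : Site d}
    (h : (evenGraph d).Adj x y) : evenValue v x y = v ⟨(x, y), h⟩ := by
  simp [evenValue, h]

/-- Three distinct neighbours of an odd site form an even triangle. The degenerate cases rely on the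
value `0` of `evenValue` at coinciding points. -/
theorem evenValue_add_evenValue {v : (evenGraph d).Dart → ℝ}
    (hv : v ∈ plaquetteFields (evenGraph d) {3, 4}) {m x y z : Site d} (hm : Odd (∑ i, m i))
    (hx : (latticeGraph d).Adj m x) (hy : (latticeGraph d).Adj m y)
    (hz : (latticeGraph d).Adj m z) :
    evenValue v x y + evenValue v y z = evenValue v x z := by
  have anti : ∀ {p q : Site d} (h : (evenGraph d).Adj p q),
      v ⟨(p, q), h⟩ = -v ⟨(q, p), h.symm⟩ := fun h => hv.1 ⟨(_, _), h⟩
  rcases eq_or_ne x y with rfl | hxy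
  · simp [evenValue_self]
  rcases eq_or_ne y z with rfl | hyz
  · simp [evenValue_self]
  have axy := evenGraph_adj_of_adj hm hx hy hxy
  have ayz := evenGraph_adj_of_adj hm hy hz hyz
  rcases eq_or_ne x z with rfl | hxz
  · rw [evenValue_self, evenValue_of_adj _ axy, evenValue_of_adj _ ayz, anti axy]
    ring
  have axz := evenGraph_adj_of_adj hm hx hz hxz
  rw [evenValue_of_adj _ axy, evenValue_of_adj _ ayz, evenValue_of_adj _ axz]
  have hcyc := hv.2 x (.cons axy (.cons ayz (.cons axz.symm .nil))) (by
    rw [SimpleGraph.Walk.cons_isCycle_iff]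
    refine ⟨?_, ?_⟩
    · simp only [SimpleGraph.Walk.isPath_def]; simp; grind
    · simp; grind) (by simp)
  simp only [SimpleGraph.Walk.darts_cons, SimpleGraph.Walk.darts_nil, List.map_cons,
    List.map_nil, List.sum_cons, List.sum_nil] at hcyc
  rw [anti axz]
  linarith

open Classical in
/-- A field on the bonds of `ℤ^d` that induces the field `v` on the even bonds: the height at an
odd site `m` is taken to be the height at `m + e_k`. -/
def liftField (k : Dir d) (v : (evenGraph d).Dart → ℝ) : (latticeGraph d).Dart → ℝ := fun b =>
  if Odd (∑ i, b.fst i) then evenValue v (b.fst + unitVec k) b.snd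
  else -evenValue v (b.snd + unitVec k) b.fst

/-- The auxiliary height at `m`, copied from `m + e_k`, cancels along a path through `m`. -/
theorem liftField_add_liftField (k : Dir d) {v : (evenGraph d).Dart → ℝ}
    (hv : v ∈ plaquetteFields (evenGraph d) {3, 4}) {m x y : Site d} (hm : Odd (∑ i, m i))
    (hx : (latticeGraph d).Adj x m) (hy : (latticeGraph d).Adj m y) :
    liftField k v ⟨(x, m), hx⟩ + liftField k v ⟨(m, y), hy⟩ = evenValue v x y := by
  have hx' : ¬ Odd (∑ i, x i) := (latticeGraph_adj_parity hx.symm).1 hm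
  simp only [liftField, hm, hx', if_true, if_false]
  have h1 := evenValue_add_evenValue hv hm (adj_add_unitVec m k) hx.symm hy
  linarith

theorem liftField_mem_plaquetteFields (k : Dir d) {v : (evenGraph d).Dart → ℝ}
    (hv : v ∈ plaquetteFields (evenGraph d) {3, 4}) :
    liftField k v ∈ plaquetteFields (latticeGraph d) {4} := by
  refine ⟨fun b => ?_, fun u p _ hN => ?_⟩
  · obtain ⟨⟨x, y⟩, hb⟩ := b
    by_cases hx : Odd (∑ i, x i)
    · have hy := (latticeGraph_adj_parity hb).1 hx
      simp [liftField, hx, hy]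
    · have hy : Odd (∑ i, y i) := by
        by_contra h; exact hx ((latticeGraph_adj_parity hb).2 h)
      simp [liftField, hx, hy]
  · have back : ∀ {m x y : Site d} (_ : Odd (∑ i, m i)) (_ : (latticeGraph d).Adj m x)
        (_ : (latticeGraph d).Adj m y), evenValue v x y + evenValue v y x = 0 :=
      fun hm hx hy => by
        rw [evenValue_add_evenValue hv hm hx hy hx, evenValue_self]
    match p, hN with
    | .cons h1 (.cons h2 (.cons h3 (.cons h4 .nil))), _ =>
      rename_i a b c _ _
      simp only [SimpleGraph.Walk.darts_cons, SimpleGraph.Walk.darts_nil, List.map_cons,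
        List.map_nil, List.sum_cons, List.sum_nil]
      -- Odd and even sites alternate along the loop. Pairing the bonds at each of the two odd sites
      -- leaves one even difference and its reverse.
      by_cases hu : Odd (∑ i, u i)
      · have hb : Odd (∑ i, b i) := by
          have q1 := latticeGraph_adj_parity h1
          have q2 := latticeGraph_adj_parity h2
          tauto
        have r1 := liftField_add_liftField k hv hb h2 h3
        have r2 := liftField_add_liftField k hv hu h4 h1
        have r3 := back hb h2.symm h3
        linarith
      · have q1 := latticeGraph_adj_parity h1
        have q2 := latticeGraph_adj_parity h2
        have q3 := latticeGraph_adj_parity h3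
        have ha : Odd (∑ i, a i) := by tauto
        have hc : Odd (∑ i, c i) := by tauto
        have r1 := liftField_add_liftField k hv ha h1 h2
        have r2 := liftField_add_liftField k hv hc h3 h4
        have r3 := back ha h1.symm h2
        linarith
    | .nil, h => simp at h
    | .cons _ .nil, h => simp at h
    | .cons _ (.cons _ .nil), h => simp at h
    | .cons _ (.cons _ (.cons _ .nil)), h => simp at h
    | .cons _ (.cons _ (.cons _ (.cons _ (.cons _ _)))), h => simp at h

theorem odd_of_common_neighbor (b : (evenGraph d).Dart) {m : Site d}
    (h : (latticeGraph d).Adj b.fst m) : Odd (∑ i, m i) := by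
  have h1 : Even (∑ i, b.fst i) := b.adj.1
  have := latticeGraph_adj_parity h.symm
  exact this.2 (Int.not_odd_iff_even.2 h1)

theorem evenField_liftField (k : Dir d) {v : (evenGraph d).Dart → ℝ}
    (hv : v ∈ plaquetteFields (evenGraph d) {3, 4}) : evenField (liftField k v) = v := by
  funext b
  obtain ⟨m, h1, h2⟩ := exists_mid b
  rw [evenField_eq (liftField_mem_plaquetteFields k hv) b m h1 h2,
    liftField_add_liftField k hv (odd_of_common_neighbor b h1) h1 h2, evenValue_of_adj _ b.adj]

open Classical in
/-- The height function that vanishes on the even sites and is equal to `c` on the odd sites. -/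
def oddHeight (c : Site d → ℝ) : Site d → ℝ := fun x => if Odd (∑ i, x i) then c x else 0

theorem evenField_grad_oddHeight (c : Site d → ℝ) :
    evenField (grad (latticeGraph d) (oddHeight c)) = 0 := by
  rw [evenField_grad]
  funext b
  have h1 : ¬ Odd (∑ i, b.fst i) := Int.not_odd_iff_even.2 b.adj.1
  have h2 : ¬ Odd (∑ i, b.snd i) := Int.not_odd_iff_even.2 b.adj.2.1
  simp [grad, oddHeight, h1, h2]

theorem mem_assocSet_of_adj {Λ : Finset (Site d)} {x y : Site d} (hx : x ∈ Λ)
    (h : (latticeGraph d).Adj x y) : y ∈ assocSet Λ := by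
  obtain ⟨i, rfl⟩ := exists_unitVec_of_adj h
  refine Finset.mem_union_right _ (Finset.mem_biUnion.2 ⟨x, hx, ?_⟩)
  exact Finset.mem_image_of_mem _ (Finset.mem_univ i)

/-- The neighbours adjoined to `Λ` are all odd. -/
theorem mem_of_mem_assocSet_of_even {Λ : Finset (Site d)}
    (hΛ : (Λ : Set (Site d)) ⊆ evenSites d) {x : Site d} (hx : x ∈ assocSet Λ)
    (he : ¬ Odd (∑ i, x i)) : x ∈ Λ := by
  rcases Finset.mem_union.1 hx with h | h
  · exact h
  · obtain ⟨y, hy, h⟩ := Finset.mem_biUnion.1 h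
    obtain ⟨i, -, rfl⟩ := Finset.mem_image.1 h
    have h1 : Even (∑ i, y i) := hΛ hy
    have := latticeGraph_adj_parity (adj_add_unitVec y i)
    exact absurd h1 (Int.not_even_iff_odd.2 (this.2 he))

/-- A bond of `ℤ^d` touches the associated set iff its odd end point belongs to it. -/
theorem mem_closedBonds_assocSet_iff {Λ : Finset (Site d)}
    (hΛ : (Λ : Set (Site d)) ⊆ evenSites d) (b : (latticeGraph d).Dart) :
    b ∈ closedBonds (latticeGraph d) (assocSet Λ) ↔
      (Odd (∑ i, b.fst i) ∧ b.fst ∈ assocSet Λ) ∨ (Odd (∑ i, b.snd i) ∧ b.snd ∈ assocSet Λ) := by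
  have hp := latticeGraph_adj_parity b.adj
  constructor
  · rintro (h | h)
    · by_cases ho : Odd (∑ i, b.fst i)
      · exact Or.inl ⟨ho, h⟩
      · exact Or.inr ⟨by tauto,
          mem_assocSet_of_adj (mem_of_mem_assocSet_of_even hΛ h ho) b.adj⟩
    · by_cases ho : Odd (∑ i, b.snd i)
      · exact Or.inr ⟨ho, h⟩
      · exact Or.inl ⟨by tauto,
          mem_assocSet_of_adj (mem_of_mem_assocSet_of_even hΛ h ho) b.adj.symm⟩
  · rintro (⟨-, h⟩ | ⟨-, h⟩)
    · exact Or.inl h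
    · exact Or.inr h

theorem evenValue_eq_zero_of_notMem {Λ : Finset (Site d)} {v : (evenGraph d).Dart → ℝ}
    (hv : ∀ b ∉ closedBonds (evenGraph d) Λ, v b = 0) {m x y : Site d} (hm : m ∉ assocSet Λ)
    (hx : (latticeGraph d).Adj x m) (hy : (latticeGraph d).Adj y m) : evenValue v x y = 0 := by
  unfold evenValue
  split_ifs with h
  · refine hv _ ?_
    rintro (h | h)
    · exact hm (mem_assocSet_of_adj h hx)
    · exact hm (mem_assocSet_of_adj h hy)
  · rfl

/-- The lift at a bond with odd end `m` is a difference between two neighbours of `m`; if `m` is not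
in the associated set, neither neighbour is in `Λ`. Thus lifting takes directions of `Λ` to
directions of its associated set. -/
theorem liftField_eq_zero (k : Dir d) {Λ : Finset (Site d)} {v : (evenGraph d).Dart → ℝ}
    (hv : ∀ b ∉ closedBonds (evenGraph d) Λ, v b = 0) (b : (latticeGraph d).Dart)
    (hb : b ∉ closedBonds (latticeGraph d) (assocSet Λ)) : liftField k v b = 0 := by
  have h1 : b.fst ∉ assocSet Λ := fun h => hb (Or.inl h)
  have h2 : b.snd ∉ assocSet Λ := fun h => hb (Or.inr h)
  unfold liftField
  split_ifs with h
  · exact evenValue_eq_zero_of_notMem hv h1 (adj_add_unitVec _ k).symm b.adj.symm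
  · rw [evenValue_eq_zero_of_notMem hv h2 (adj_add_unitVec _ k).symm b.adj, neg_zero]

theorem grad_oddHeight_eq_zero {Λ : Finset (Site d)} {c : Site d → ℝ} (hc : ∀ x ∉ Λ, c x = 0)
    (b : (latticeGraph d).Dart) (hb : b ∉ closedBonds (latticeGraph d) Λ) :
    grad (latticeGraph d) (oddHeight c) b = 0 := by
  have h1 : b.fst ∉ Λ := fun h => hb (Or.inl h)
  have h2 : b.snd ∉ Λ := fun h => hb (Or.inr h)
  simp [grad, oddHeight, hc _ h1, hc _ h2]

end Lift

open scoped ENNReal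

/-! ### Directions, finite volume kernels and the DLR equation on a general graph -/

section Graph

variable {d : ℕ} {G : SimpleGraph (Site d)}

instance countable_dart : Countable G.Dart :=
  Function.Injective.countable (f := fun b : G.Dart => b.toProd)
    fun a b h => SimpleGraph.Dart.ext a b h

/-- Extension by zero of a direction to a field on all bonds. -/
def extend (G : SimpleGraph (Site d)) (N : Set ℕ) (Λ : Finset (Site d)) :
    directions G N Λ →ₗ[ℝ] (G.Dart → ℝ) where
  toFun v := glue G Λ v.1.ofLp 0
  map_add' v w := by
    funext b; by_cases h : b ∈ closedBonds G Λ <;> simp [glue, h]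
  map_smul' c v := by
    funext b; by_cases h : b ∈ closedBonds G Λ <;> simp [glue, h]

theorem extend_apply_mem {N : Set ℕ} {Λ : Finset (Site d)} (v : directions G N Λ)
    (b : closedBonds G Λ) : extend G N Λ v b = v.1.ofLp b := by
  simp [extend, glue]

theorem extend_apply_notMem {N : Set ℕ} {Λ : Finset (Site d)} (v : directions G N Λ) (b : G.Dart)
    (hb : b ∉ closedBonds G Λ) : extend G N Λ v b = 0 := by
  simp [extend, glue, hb]

theorem extend_mem {N : Set ℕ} {Λ : Finset (Site d)} (v : directions G N Λ) :
    extend G N Λ v ∈ plaquetteFields G N := v.2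

/-- Identifies the directions of `Λ` with the plaquette fields vanishing off its bonds, so that
shifts can be handled as fields on all bonds. -/
theorem exists_extend_eq {N : Set ℕ} {Λ : Finset (Site d)} {ζ : G.Dart → ℝ}
    (hζ : ζ ∈ plaquetteFields G N) (h0 : ∀ b ∉ closedBonds G Λ, ζ b = 0) :
    ∃ v, extend G N Λ v = ζ := by
  have e : glue G Λ (fun b => ζ b) 0 = ζ := by
    funext b
    by_cases h : b ∈ closedBonds G Λ
    · simp [glue, h]
    · simp [glue, h, h0 b h]
  exact ⟨⟨WithLp.toLp 2 fun b => ζ b, show glue G Λ (fun b => ζ b) 0 ∈ _ by rwa [e]⟩, e⟩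

theorem shift_eq (N : Set ℕ) (Λ : Finset (Site d)) (ξ : G.Dart → ℝ) (v : directions G N Λ) :
    shift G N Λ ξ v = ξ + extend G N Λ v := by
  funext b; by_cases h : b ∈ closedBonds G Λ <;> simp [shift, extend, glue, h]

/-- Each condition is closed, as it involves finitely many coordinates. Needed for the measurability
of the set of plaquette fields. -/
theorem isClosed_plaquetteFields (N : Set ℕ) :
    IsClosed (plaquetteFields G N : Set (G.Dart → ℝ)) := by
  have e : (plaquetteFields G N : Set (G.Dart → ℝ)) = (⋂ b : G.Dart, {η | η b = -η b.symm}) ∩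
      ⋂ (u : Site d) (p : G.Walk u u) (_ : p.IsCycle) (_ : p.length ∈ N),
        {η | (p.darts.map η).sum = 0} := by
    ext η
    simp [plaquetteFields]
  rw [e]
  refine (isClosed_iInter fun b => isClosed_eq (by fun_prop) (by fun_prop)).inter ?_
  refine isClosed_iInter fun u => isClosed_iInter fun p => isClosed_iInter fun _ =>
    isClosed_iInter fun _ => isClosed_eq ?_ continuous_const
  induction p.darts with
  | nil => simpa using continuous_const
  | cons a l ih =>
    simp only [List.map_cons, List.sum_cons]
    exact (continuous_apply a).add ih

theorem outsideField_eq_comap (Λ : Finset (Site d)) :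
    outsideField G Λ = MeasurableSpace.comap
      (fun (η : G.Dart → ℝ) (b : ((closedBonds G Λ)ᶜ : Set G.Dart)) => η b) inferInstance := by
  simp only [outsideField, MeasurableSpace.pi, MeasurableSpace.comap_iSup,
    MeasurableSpace.comap_comp, iSup_subtype]
  rfl

theorem outsideField_le (Λ : Finset (Site d)) :
    outsideField G Λ ≤ (MeasurableSpace.pi : MeasurableSpace (G.Dart → ℝ)) := by
  rw [outsideField_eq_comap]
  exact Measurable.comap_le (by fun_prop)

/-- Sets that are determined outside of `Λ` do not change under shifts inside of `Λ`. -/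
theorem mem_add_iff_of_outsideField {Λ : Finset (Site d)} {s : Set (G.Dart → ℝ)}
    (hs : MeasurableSet[outsideField G Λ] s) {ζ : G.Dart → ℝ}
    (hζ : ∀ b ∉ closedBonds G Λ, ζ b = 0) (η : G.Dart → ℝ) : η + ζ ∈ s ↔ η ∈ s := by
  rw [outsideField_eq_comap] at hs
  obtain ⟨t, -, rfl⟩ := hs
  simp only [Set.mem_preimage]
  have : (fun b : ((closedBonds G Λ)ᶜ : Set G.Dart) => (η + ζ) b) =
      fun b : ((closedBonds G Λ)ᶜ : Set G.Dart) => η b := by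
    funext b; simp [hζ b b.2]
  rw [this]

/-- The Boltzmann factor. -/
def boltzmann (E : Finset (Site d) → (G.Dart → ℝ) → ℝ) (Λ : Finset (Site d)) (η : G.Dart → ℝ) :
    ℝ≥0∞ := ENNReal.ofReal (Real.exp (-E Λ η))

theorem boltzmann_ne_zero (E : Finset (Site d) → (G.Dart → ℝ) → ℝ) (Λ : Finset (Site d))
    (η : G.Dart → ℝ) : boltzmann E Λ η ≠ 0 := by
  simp [boltzmann, Real.exp_pos]

theorem boltzmann_ne_top (E : Finset (Site d) → (G.Dart → ℝ) → ℝ) (Λ : Finset (Site d))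
    (η : G.Dart → ℝ) : boltzmann E Λ η ≠ ∞ := ENNReal.ofReal_ne_top

theorem measurable_boltzmann {E : Finset (Site d) → (G.Dart → ℝ) → ℝ} {Λ : Finset (Site d)}
    (hE : Measurable (E Λ)) : Measurable (boltzmann E Λ) :=
  (Real.measurable_exp.comp hE.neg).ennreal_ofReal

variable [G.LocallyFinite]

theorem continuous_extend (N : Set ℕ) (Λ : Finset (Site d)) : Continuous (extend G N Λ) :=
  LinearMap.continuous_of_finiteDimensional _

/-- Lebesgue measure on the space of directions. -/
abbrev lebDir (G : SimpleGraph (Site d)) [G.LocallyFinite] (N : Set ℕ) (Λ : Finset (Site d)) :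
    Measure (directions G N Λ) :=
  (stdOrthonormalBasis ℝ (directions G N Λ)).toBasis.addHaar

/-- There is a map, measurable with respect to the field outside of `Λ`, which moves every
plaquette field by a direction of `Λ`. -/
theorem exists_outside_section (N : Set ℕ) (Λ : Finset (Site d)) :
    ∃ ρ : (G.Dart → ℝ) → G.Dart → ℝ, Measurable[outsideField G Λ] ρ ∧
      ∀ ξ ∈ plaquetteFields G N, ∃ v, ρ ξ = ξ + extend G N Λ v := by
  let R : (G.Dart → ℝ) → EuclideanSpace ℝ (closedBonds G Λ) :=
    fun ξ => WithLp.toLp 2 fun b => ξ b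
  let π : (G.Dart → ℝ) → directions G N Λ := fun ξ => (directions G N Λ).orthogonalProjectionOnto (R ξ)
  have hR : Continuous R := by fun_prop
  have hπ : Continuous π := (directions G N Λ).orthogonalProjectionOnto.continuous.comp hR
  let res : (G.Dart → ℝ) → ((closedBonds G Λ)ᶜ : Set G.Dart) → ℝ := fun ξ b => ξ b
  have hres : Continuous res := by fun_prop
  -- A slice that meets each class of plaquette fields modulo directions of `Λ` in exactly one
  -- point, namely `ξ` shifted by `-π ξ`.
  let T : Set (G.Dart → ℝ) := {ξ | ξ ∈ plaquetteFields G N ∧ π ξ = 0}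
  have hRe : ∀ (ξ : G.Dart → ℝ) (v : directions G N Λ), R (ξ + extend G N Λ v) = R ξ + v := by
    intro ξ v
    ext b
    simp [R, extend_apply_mem]
  have hπe : ∀ (ξ : G.Dart → ℝ) (v : directions G N Λ), π (ξ + extend G N Λ v) = π ξ + v := by
    intro ξ v
    simp [π, hRe]
  have hTm : MeasurableSet T :=
    ((isClosed_plaquetteFields N).inter (isClosed_singleton.preimage hπ)).measurableSet
  have hinj : Set.InjOn res T := by
    rintro ξ ⟨h1, h2⟩ ζ ⟨h3, h4⟩ h
    obtain ⟨v, hv⟩ := exists_extend_eq (Λ := Λ) (sub_mem h1 h3)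
      (fun b hb => by simpa [res, sub_eq_zero] using congrFun h ⟨b, hb⟩)
    have e : ξ = ζ + extend G N Λ v := by rw [hv]; abel
    rw [e, hπe, h4, zero_add] at h2
    rw [e, h2, map_zero, add_zero]
  -- Lusin–Souslin: there are countably many bonds, so the spaces are Polish, and an injective
  -- continuous map on a Borel set has a measurable inverse.
  have hemb := hres.continuousOn.measurableEmbedding hTm hinj
  obtain ⟨g, hg, hgT⟩ := hemb.exists_measurable_extend (g := fun ξ : T => (ξ : G.Dart → ℝ))
    measurable_subtype_coe (fun _ => inferInstance)
  refine ⟨g ∘ res, ?_, fun ξ hξ => ⟨-π ξ, ?_⟩⟩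
  · rw [outsideField_eq_comap]
    exact hg.comp (comap_measurable _)
  · have hT : ξ + extend G N Λ (-π ξ) ∈ T :=
      ⟨add_mem hξ (extend_mem _), by rw [hπe, add_neg_cancel]⟩
    have h1 := congrFun hgT ⟨_, hT⟩
    have h2 : res (ξ + extend G N Λ (-π ξ)) = res ξ := by
      funext b
      simp only [res, Pi.add_apply]
      rw [extend_apply_notMem _ _ b.2, add_zero]
    simp only [Function.comp, Set.domRestrict_apply] at h1 ⊢
    rw [← h1, h2]

/-- The integral over the directions, as a function of the boundary condition. -/
def dirIntegral (N : Set ℕ) (Λ : Finset (Site d)) (f : (G.Dart → ℝ) → ℝ≥0∞) (ξ : G.Dart → ℝ) :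
    ℝ≥0∞ := ∫⁻ v, f (ξ + extend G N Λ v) ∂lebDir G N Λ

theorem measurable_dirIntegral (N : Set ℕ) (Λ : Finset (Site d)) {f : (G.Dart → ℝ) → ℝ≥0∞}
    (hf : Measurable f) : Measurable (dirIntegral N Λ f) := by
  refine Measurable.lintegral_prod_right' (ν := lebDir G N Λ)
    (f := fun p : (G.Dart → ℝ) × directions G N Λ => f (p.1 + extend G N Λ p.2)) ?_
  have := (continuous_extend (G := G) N Λ).measurable
  fun_prop

/-- Translation invariance of Lebesgue measure on the directions. -/
theorem dirIntegral_add_extend (N : Set ℕ) (Λ : Finset (Site d)) (f : (G.Dart → ℝ) → ℝ≥0∞)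
    (ξ : G.Dart → ℝ) (v : directions G N Λ) :
    dirIntegral N Λ f (ξ + extend G N Λ v) = dirIntegral N Λ f ξ := by
  unfold dirIntegral
  rw [← lintegral_add_left_eq_self (μ := lebDir G N Λ) (fun w => f (ξ + extend G N Λ w)) v]
  simp only [map_add, add_assoc]

/-- Holds without any bound on the partition function, since the normalization is an inverse in
`ℝ≥0∞` on both sides. -/
theorem lintegral_finiteVolume (N : Set ℕ) {E : Finset (Site d) → (G.Dart → ℝ) → ℝ}
    {Λ : Finset (Site d)} (hE : Measurable (E Λ)) {f : (G.Dart → ℝ) → ℝ≥0∞} (hf : Measurable f)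
    (ξ : G.Dart → ℝ) :
    ∫⁻ η, f η ∂finiteVolume G N E Λ ξ =
      (dirIntegral N Λ (boltzmann E Λ) ξ)⁻¹ *
        dirIntegral N Λ (fun η => boltzmann E Λ η * f η) ξ := by
  have hb := measurable_boltzmann hE
  have hsh : Measurable (shift G N Λ ξ) := by
    have := (continuous_extend (G := G) N Λ).measurable
    have e : shift G N Λ ξ = fun v => ξ + extend G N Λ v := funext (shift_eq N Λ ξ)
    rw [e]
    fun_prop
  have key : ∀ f : (G.Dart → ℝ) → ℝ≥0∞, Measurable f →
      ∫⁻ η, f η ∂unnormalized G N E Λ ξ = dirIntegral N Λ (fun η => boltzmann E Λ η * f η) ξ := by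
    intro f hf
    change ∫⁻ η, f η ∂(lebesgue G N Λ ξ).withDensity (boltzmann E Λ) = _
    rw [lintegral_withDensity_eq_lintegral_mul _ hb hf, lebesgue, lintegral_map (hb.mul hf) hsh]
    simp only [shift_eq, Pi.mul_apply, dirIntegral]
  have htot : unnormalized G N E Λ ξ Set.univ = dirIntegral N Λ (boltzmann E Λ) ξ := by
    have := key (fun _ => 1) measurable_const
    simpa using this
  rw [finiteVolume, lintegral_smul_measure, key f hf, htot, smul_eq_mul]

theorem finiteVolume_apply (N : Set ℕ) {E : Finset (Site d) → (G.Dart → ℝ) → ℝ}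
    {Λ : Finset (Site d)} (hE : Measurable (E Λ)) {A : Set (G.Dart → ℝ)} (hA : MeasurableSet A)
    (ξ : G.Dart → ℝ) :
    finiteVolume G N E Λ ξ A =
      (dirIntegral N Λ (boltzmann E Λ) ξ)⁻¹ *
        dirIntegral N Λ (fun η => boltzmann E Λ η * A.indicator 1 η) ξ := by
  rw [← lintegral_finiteVolume N hE (measurable_one.indicator hA), lintegral_indicator_one hA]

theorem measurable_finiteVolume (N : Set ℕ) {E : Finset (Site d) → (G.Dart → ℝ) → ℝ}
    {Λ : Finset (Site d)} (hE : Measurable (E Λ)) : Measurable (finiteVolume G N E Λ) := by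
  refine Measure.measurable_of_measurable_coe _ fun A hA => ?_
  simp only [finiteVolume_apply N hE hA]
  exact (measurable_dirIntegral N Λ (measurable_boltzmann hE)).inv.mul
    (measurable_dirIntegral N Λ ((measurable_boltzmann hE).mul (measurable_one.indicator hA)))

theorem finiteVolume_add_extend (N : Set ℕ) {E : Finset (Site d) → (G.Dart → ℝ) → ℝ}
    {Λ : Finset (Site d)} (hE : Measurable (E Λ)) (ξ : G.Dart → ℝ) (v : directions G N Λ) :
    finiteVolume G N E Λ (ξ + extend G N Λ v) = finiteVolume G N E Λ ξ := by
  ext A hA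
  simp only [finiteVolume_apply N hE hA, dirIntegral_add_extend]

theorem finiteVolume_le_one (N : Set ℕ) (E : Finset (Site d) → (G.Dart → ℝ) → ℝ)
    (Λ : Finset (Site d)) (ξ : G.Dart → ℝ) (A : Set (G.Dart → ℝ)) :
    finiteVolume G N E Λ ξ A ≤ 1 := by
  refine (measure_mono (Set.subset_univ A)).trans ?_
  simp only [finiteVolume, Measure.smul_apply, smul_eq_mul]
  exact ENNReal.inv_mul_le_one _

/-- The integrated form of the DLR equation. -/
theorem IsGradGibbs.bind_finiteVolume {S : Set (Site d)} {N : Set ℕ}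
    {E : Finset (Site d) → (G.Dart → ℝ) → ℝ} {μ : Measure (G.Dart → ℝ)}
    (hμ : IsGradGibbs G S N E μ) {Λ : Finset (Site d)} (hΛ : (Λ : Set (Site d)) ⊆ S)
    (hE : Measurable (E Λ)) : μ.bind (finiteVolume G N E Λ) = μ := by
  have := hμ.prob
  ext A hA
  have hm := measurable_finiteVolume (G := G) N hE
  rw [Measure.bind_apply hA hm.aemeasurable]
  have h1 : ∫ ξ, (finiteVolume G N E Λ ξ).real A ∂μ = μ.real A := by
    rw [← integral_congr_ae (hμ.dlr Λ hΛ A hA), integral_condExp (outsideField_le Λ)]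
    simp [integral_indicator hA]
  have hlt : ∀ ξ, finiteVolume G N E Λ ξ A < ∞ := fun ξ =>
    (finiteVolume_le_one N E Λ ξ A).trans_lt ENNReal.one_lt_top
  have h2 : ∫⁻ ξ, finiteVolume G N E Λ ξ A ∂μ ≠ ∞ := by
    refine ne_top_of_le_ne_top (b := 1) ENNReal.one_ne_top ?_
    calc _ ≤ ∫⁻ _, 1 ∂μ := lintegral_mono fun ξ => finiteVolume_le_one N E Λ ξ A
      _ = 1 := by simp
  have h3 := integral_toReal (μ := μ) (f := fun ξ => finiteVolume G N E Λ ξ A)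
    ((Measure.measurable_coe hA).comp hm).aemeasurable (Filter.Eventually.of_forall hlt)
  rw [← ENNReal.toReal_eq_toReal_iff' h2 (measure_ne_top μ A), ← h3]
  exact h1

/-- Under a Gibbs measure, shifts by directions of `Λ` act with density given by the ratio of the
Boltzmann factors. -/
theorem IsGradGibbs.lintegral_add_extend {S : Set (Site d)} {N : Set ℕ}
    {E : Finset (Site d) → (G.Dart → ℝ) → ℝ} {μ : Measure (G.Dart → ℝ)}
    (hμ : IsGradGibbs G S N E μ) {Λ : Finset (Site d)} (hΛ : (Λ : Set (Site d)) ⊆ S)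
    (hE : Measurable (E Λ)) {f : (G.Dart → ℝ) → ℝ≥0∞} (hf : Measurable f)
    (v : directions G N Λ) :
    ∫⁻ η, f (η + extend G N Λ v) * (boltzmann E Λ η)⁻¹ ∂μ =
      ∫⁻ η, f η * (boltzmann E Λ η)⁻¹ ∂μ := by
  have hb := measurable_boltzmann hE
  have hm := measurable_finiteVolume (G := G) N hE
  -- Dividing by the Boltzmann factor leaves a mixture of Lebesgue measures on the classes modulo
  -- directions, with weights `1/Z` that are constant on each class.
  have key : ∀ f : (G.Dart → ℝ) → ℝ≥0∞, Measurable f →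
      ∫⁻ η, f η * (boltzmann E Λ η)⁻¹ ∂μ =
        ∫⁻ ξ, (dirIntegral N Λ (boltzmann E Λ) ξ)⁻¹ * dirIntegral N Λ f ξ ∂μ := by
    intro f hf
    conv_lhs => rw [← hμ.bind_finiteVolume hΛ hE]
    have hfm : Measurable fun η => f η * (boltzmann E Λ η)⁻¹ := hf.mul hb.inv
    rw [Measure.lintegral_bind hm.aemeasurable hfm.aemeasurable]
    refine lintegral_congr fun ξ => ?_
    rw [lintegral_finiteVolume N hE hfm]
    congr 2
    funext η
    rw [mul_comm (f η), ← mul_assoc,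
      ENNReal.mul_inv_cancel (boltzmann_ne_zero _ _ _) (boltzmann_ne_top _ _ _), one_mul]
  rw [key f hf, key (fun η => f (η + extend G N Λ v)) (by fun_prop)]
  refine lintegral_congr fun ξ => ?_
  rw [← dirIntegral_add_extend N Λ f ξ v]
  simp only [dirIntegral, add_right_comm]

/-- The DLR equation for `Λ` follows from its form integrated over sets that are determined
outside of `Λ`. -/
theorem condExp_eq_finiteVolume {N : Set ℕ} {E : Finset (Site d) → (G.Dart → ℝ) → ℝ}
    {μ : Measure (G.Dart → ℝ)} [IsProbabilityMeasure μ]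
    (hc : ∀ᵐ η ∂μ, η ∈ plaquetteFields G N) {Λ : Finset (Site d)} (hE : Measurable (E Λ))
    {A : Set (G.Dart → ℝ)} (hA : MeasurableSet A)
    (h : ∀ s, MeasurableSet[outsideField G Λ] s →
      ∫⁻ ξ in s, finiteVolume G N E Λ ξ A ∂μ = μ (A ∩ s)) :
    μ[A.indicator (fun _ => (1 : ℝ)) | outsideField G Λ]
      =ᵐ[μ] fun ξ => (finiteVolume G N E Λ ξ).real A := by
  have hm : Measurable fun ξ => finiteVolume G N E Λ ξ A :=
    (Measure.measurable_coe hA).comp (measurable_finiteVolume (G := G) N hE)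
  have hlt : ∀ ξ, finiteVolume G N E Λ ξ A < ∞ := fun ξ =>
    (finiteVolume_le_one N E Λ ξ A).trans_lt ENNReal.one_lt_top
  symm
  refine ae_eq_condExp_of_forall_setIntegral_eq (outsideField_le Λ)
    ((integrable_const (1 : ℝ)).indicator hA) (fun s _ _ => ?_) (fun s hs _ => ?_) ?_
  · refine Integrable.integrableOn ⟨hm.ennreal_toReal.aestronglyMeasurable,
      HasFiniteIntegral.of_bounded (C := 1) (Filter.Eventually.of_forall fun ξ => ?_)⟩
    rw [Real.norm_of_nonneg measureReal_nonneg]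
    exact ENNReal.toReal_mono ENNReal.one_ne_top (finiteVolume_le_one N E Λ ξ A)
  · have hs' := outsideField_le Λ s hs
    have h3 := integral_toReal (μ := μ.restrict s) hm.aemeasurable (Filter.Eventually.of_forall hlt)
    rw [h s hs] at h3
    rw [setIntegral_indicator hA]
    simp only [Measure.real, setIntegral_const, smul_eq_mul, mul_one] at h3 ⊢
    rw [h3, Set.inter_comm]
  -- The kernel formally reads `ξ` on all bonds, but it is invariant under directions, so `ξ` may be
  -- replaced by its outside-measurable representative `ρ ξ`.
  · obtain ⟨ρ, hρ, hρe⟩ := exists_outside_section (G := G) N Λ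
    refine ⟨fun ξ => (finiteVolume G N E Λ (ρ ξ)).real A,
      (hm.ennreal_toReal.comp hρ).stronglyMeasurable, ?_⟩
    filter_upwards [hc] with ξ hξ
    obtain ⟨v, hv⟩ := hρe ξ hξ
    rw [hv, finiteVolume_add_extend N hE]

end Graph

/-- Averaging over the orbits of a group of shifts under which `μ` is quasi-invariant, with
density given by ratios of `b`. -/
theorem lintegral_mul_lintegral_orbit {Ω V : Type*} [AddCommGroup Ω] [MeasurableSpace Ω]
    [MeasurableAdd₂ Ω] [AddCommGroup V] [MeasurableSpace V] [MeasurableNeg V]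
    (μ : Measure Ω) [SFinite μ] (ν : Measure V) [SFinite ν] [ν.IsNegInvariant]
    (T : V →+ Ω) (hT : Measurable T) {b : Ω → ℝ≥0∞} (hb : Measurable b) (hb0 : ∀ η, b η ≠ 0)
    (hbt : ∀ η, b η ≠ ∞)
    (hinv : ∀ w, ∀ P : Ω → ℝ≥0∞, Measurable P →
      ∫⁻ η, P (η + T w) * (b η)⁻¹ ∂μ = ∫⁻ η, P η * (b η)⁻¹ ∂μ)
    {g f : Ω → ℝ≥0∞} (hg : Measurable g) (hgT : ∀ η w, g (η + T w) = g η) (hf : Measurable f) :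
    ∫⁻ η, g η * ∫⁻ w, b (η + T w) * f (η + T w) ∂ν ∂μ =
      ∫⁻ η, g η * f η * ∫⁻ w, b (η + T w) ∂ν ∂μ := by
  have step : ∀ w, ∫⁻ η, g η * (b (η + T w) * f (η + T w)) ∂μ =
      ∫⁻ η, g η * f η * b (η + T (-w)) ∂μ := by
    intro w
    -- The last factor becomes `b η` after the shift by `T w` and cancels the density; without the
    -- shift, `b η` cancels it instead.
    have h := hinv w (fun η => g η * (b η * f η) * b (η + T (-w))) (by fun_prop)
    calc _ = ∫⁻ η, g (η + T w) * (b (η + T w) * f (η + T w)) * b (η + T w + T (-w)) *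
          (b η)⁻¹ ∂μ := by
          refine lintegral_congr fun η => ?_
          rw [hgT, map_neg, add_neg_cancel_right, mul_assoc _ (b η),
            ENNReal.mul_inv_cancel (hb0 η) (hbt η), mul_one]
      _ = _ := h
      _ = _ := by
          refine lintegral_congr fun η => ?_
          calc g η * (b η * f η) * b (η + T (-w)) * (b η)⁻¹
              = g η * f η * b (η + T (-w)) * (b η * (b η)⁻¹) := by ring
            _ = _ := by rw [ENNReal.mul_inv_cancel (hb0 η) (hbt η), mul_one]
  calc _ = ∫⁻ η, ∫⁻ w, g η * (b (η + T w) * f (η + T w)) ∂ν ∂μ := by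
        refine lintegral_congr fun η => ?_
        rw [lintegral_const_mul _ (by fun_prop)]
    _ = ∫⁻ w, ∫⁻ η, g η * (b (η + T w) * f (η + T w)) ∂μ ∂ν :=
        lintegral_lintegral_swap (by fun_prop)
    _ = ∫⁻ w, ∫⁻ η, g η * f η * b (η + T (-w)) ∂μ ∂ν := lintegral_congr step
    _ = ∫⁻ w, ∫⁻ η, g η * f η * b (η + T w) ∂μ ∂ν :=
        lintegral_neg_eq_self (fun w => ∫⁻ η, g η * f η * b (η + T w) ∂μ)
    _ = ∫⁻ η, ∫⁻ w, g η * f η * b (η + T w) ∂ν ∂μ :=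
        lintegral_lintegral_swap (by fun_prop)
    _ = _ := by
        refine lintegral_congr fun η => ?_
        rw [lintegral_const_mul _ (by fun_prop)]

/-! ### Even directions together with odd heights, as directions on `ℤ^d` -/

section Fiber

variable {d : ℕ}

/-- The odd sites of the set associated to `Λ`. -/
def oddSites (Λ : Finset (Site d)) : Finset (Site d) :=
  (assocSet Λ).filter fun x => Odd (∑ i, x i)

theorem mem_oddSites {Λ : Finset (Site d)} {x : Site d} :
    x ∈ oddSites Λ ↔ x ∈ assocSet Λ ∧ Odd (∑ i, x i) := Finset.mem_filter

/-- The odd sites of the set associated to `Λ`, as a type. -/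
abbrev OddSite (Λ : Finset (Site d)) : Type := {x // x ∈ oddSites Λ}

theorem OddSite.odd {Λ : Finset (Site d)} (x : OddSite Λ) : Odd (∑ i, x.1 i) :=
  (mem_oddSites.1 x.2).2

theorem OddSite.mem {Λ : Finset (Site d)} (x : OddSite Λ) : x.1 ∈ assocSet Λ :=
  (mem_oddSites.1 x.2).1

/-- Extension by zero of heights on the odd sites associated to `Λ`. -/
def oddExtend (Λ : Finset (Site d)) (c : OddSite Λ → ℝ) : Site d → ℝ := fun x =>
  if h : x ∈ oddSites Λ then c ⟨x, h⟩ else 0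

theorem oddExtend_apply {Λ : Finset (Site d)} (c : OddSite Λ → ℝ) (x : OddSite Λ) :
    oddExtend Λ c x = c x := by
  simp [oddExtend]

theorem oddExtend_eq_zero {Λ : Finset (Site d)} (c : OddSite Λ → ℝ) {x : Site d}
    (hx : x ∉ assocSet Λ) : oddExtend Λ c x = 0 := by
  simp [oddExtend, mem_oddSites, hx]

/-- The pairs of an even direction and heights on the odd sites. -/
abbrev FiberSpace (Λ : Finset (Site d)) : Type :=
  directions (evenGraph d) {3, 4} Λ × (OddSite Λ → ℝ)

theorem evenValue_add (v w : (evenGraph d).Dart → ℝ) (x y : Site d) :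
    evenValue (v + w) x y = evenValue v x y + evenValue w x y := by
  by_cases h : (evenGraph d).Adj x y <;> simp [evenValue, h]

theorem evenValue_smul (a : ℝ) (v : (evenGraph d).Dart → ℝ) (x y : Site d) :
    evenValue (a • v) x y = a * evenValue v x y := by
  by_cases h : (evenGraph d).Adj x y <;> simp [evenValue, h]

/-- The field on `ℤ^d` that consists of the lift of an even direction and of heights on the odd
sites. -/
def fiberField (k : Dir d) (Λ : Finset (Site d)) :
    FiberSpace Λ →ₗ[ℝ] ((latticeGraph d).Dart → ℝ) where
  toFun w := liftField k (extend (evenGraph d) {3, 4} Λ w.1) +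
    grad (latticeGraph d) (oddHeight (oddExtend Λ w.2))
  map_add' w z := by
    have h : ∀ x, oddHeight (oddExtend Λ (w.2 + z.2)) x =
        oddHeight (oddExtend Λ w.2) x + oddHeight (oddExtend Λ z.2) x := by
      intro x
      simp only [oddHeight, oddExtend, Pi.add_apply]
      split_ifs <;> simp
    funext b
    simp only [Prod.fst_add, Prod.snd_add, Pi.add_apply, map_add, liftField, evenValue_add, grad, h]
    split_ifs <;> ring
  map_smul' a w := by
    have h : ∀ x, oddHeight (oddExtend Λ (a • w.2)) x = a * oddHeight (oddExtend Λ w.2) x := by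
      intro x
      simp only [oddHeight, oddExtend, Pi.smul_apply, smul_eq_mul]
      split_ifs <;> simp
    funext b
    simp only [Prod.smul_fst, Prod.smul_snd, Pi.add_apply, Pi.smul_apply, map_smul, liftField,
      evenValue_smul, grad, h, smul_eq_mul, RingHom.id_apply]
    split_ifs <;> ring

theorem evenField_add (η ζ : (latticeGraph d).Dart → ℝ) :
    evenField (η + ζ) = evenField η + evenField ζ := by
  funext b
  simp only [evenField, Pi.add_apply]
  ring

theorem evenField_fiberField (k : Dir d) (Λ : Finset (Site d)) (w : FiberSpace Λ) :
    evenField (fiberField k Λ w) = extend (evenGraph d) {3, 4} Λ w.1 := by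
  change evenField (_ + _) = _
  rw [evenField_add, evenField_liftField k (extend_mem w.1), evenField_grad_oddHeight, add_zero]

theorem fiberField_mem (k : Dir d) (Λ : Finset (Site d)) (w : FiberSpace Λ) :
    fiberField k Λ w ∈ plaquetteFields (latticeGraph d) {4} :=
  add_mem (liftField_mem_plaquetteFields k (extend_mem w.1)) (grad_mem_plaquetteFields _ _ _)

theorem fiberField_eq_zero (k : Dir d) (Λ : Finset (Site d)) (w : FiberSpace Λ)
    (b : (latticeGraph d).Dart) (hb : b ∉ closedBonds (latticeGraph d) (assocSet Λ)) :
    fiberField k Λ w b = 0 := by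
  change _ + _ = (0 : ℝ)
  rw [liftField_eq_zero k (extend_apply_notMem w.1) b hb,
    grad_oddHeight_eq_zero (fun _ => oddExtend_eq_zero w.2) b hb, add_zero]

theorem exists_extend_eq_fiberField (k : Dir d) (Λ : Finset (Site d)) (w : FiberSpace Λ) :
    ∃ v, extend (latticeGraph d) {4} (assocSet Λ) v = fiberField k Λ w :=
  exists_extend_eq (fiberField_mem k Λ w) (fiberField_eq_zero k Λ w)

/-- The induced even field recovers the even direction; the bonds at odd sites then recover the
heights. Used for the coercivity of the energy along orbits. -/
theorem fiberField_injective (k : Dir d) (Λ : Finset (Site d)) :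
    Function.Injective (fiberField k Λ) := by
  rw [injective_iff_map_eq_zero]
  rintro ⟨v, c⟩ h
  have hv : v = 0 := by
    have h1 := evenField_fiberField k Λ (v, c)
    have h0 : evenField (0 : (latticeGraph d).Dart → ℝ) = 0 := by funext b; simp [evenField]
    rw [h, h0] at h1
    ext b
    have := congrFun h1 b
    rw [extend_apply_mem] at this
    simpa using this.symm
  subst hv
  refine Prod.ext rfl (funext fun x => ?_)
  have h2 := congrFun h ⟨(x.1, x.1 + unitVec k), adj_add_unitVec x.1 k⟩
  have hx : Odd (∑ i, x.1 i) := x.odd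
  have hy := (latticeGraph_adj_parity (adj_add_unitVec x.1 k)).1 hx
  change liftField k (extend (evenGraph d) {3, 4} Λ 0) _ + grad _ _ _ = (0 : ℝ) at h2
  simp only [map_zero, liftField, grad, oddHeight, hx, hy, if_true, if_false, evenValue_self,
    oddExtend_apply] at h2
  simpa using h2

theorem continuous_fiberField (k : Dir d) (Λ : Finset (Site d)) : Continuous (fiberField k Λ) :=
  LinearMap.continuous_of_finiteDimensional _

end Fiber

/-! ### The energies -/

section Energy

variable {d : ℕ} {U : ℝ → ℝ} {β : ℝ}

theorem measurable_pairEnergy (hU : Continuous U) (β : ℝ) (Λ : Finset (Site d)) :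
    Measurable (pairEnergy (d := d) β U Λ) := by
  have := hU.measurable
  unfold pairEnergy
  fun_prop

theorem measurable_evenEnergy (hU : Continuous U) (β : ℝ) (k : Dir d) (Λ : Finset (Site d)) :
    Measurable (evenEnergy β U k Λ) := by
  have h1 : Measurable (oddPotential (d := d) β U) := by
    unfold oddPotential
    refine (Real.measurable_log.comp ?_).neg
    refine StronglyMeasurable.measurable ?_
    refine StronglyMeasurable.integral_prod_right (ν := volume)
      (f := fun (a : Dir d → ℝ) (t : ℝ) => Real.exp (-(2 * β * ∑ i, U (a i - t)))) ?_
    refine Continuous.stronglyMeasurable ?_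
    unfold Function.uncurry
    fun_prop
  have h2 : ∀ x y : Site d, Measurable fun η : (evenGraph d).Dart → ℝ => evenValue η x y := by
    intro x y
    unfold evenValue
    split_ifs
    · exact measurable_pi_apply _
    · exact measurable_const
  unfold evenEnergy
  exact Finset.measurable_sum _ fun x _ => h1.comp (measurable_pi_lambda _ fun i => h2 _ _)

/-- The energy at an odd site, as a function of the height differences to its neighbours. -/
def siteEnergy (β : ℝ) (U : ℝ → ℝ) (a : Dir d → ℝ) : ℝ := 2 * β * ∑ i, U (a i)

/-- The height differences from a site to its neighbours. -/
def star (η : (latticeGraph d).Dart → ℝ) (x : Site d) : Dir d → ℝ :=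
  fun i => η ⟨(x, x + unitVec i), adj_add_unitVec x i⟩

/-- The bonds touching the associated set are the bonds leaving its odd sites and their reversals.
Both orientations have the same energy, whence the `2` in `siteEnergy`. -/
theorem pairEnergy_eq_sum (hsymm : ∀ s, U (-s) = U s) {Λ : Finset (Site d)}
    (hΛ : (Λ : Set (Site d)) ⊆ evenSites d) {η : (latticeGraph d).Dart → ℝ}
    (hη : ∀ b, η b = -η b.symm) :
    pairEnergy β U (assocSet Λ) η = ∑ x : OddSite Λ, siteEnergy β U (star η x) := by
  let D : OddSite Λ × Dir d → (latticeGraph d).Dart :=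
    fun p => ⟨(p.1.1, p.1.1 + unitVec p.2), adj_add_unitVec p.1.1 p.2⟩
  let f : (OddSite Λ × Dir d) ⊕ (OddSite Λ × Dir d) →
      closedBonds (latticeGraph d) (assocSet Λ) :=
    Sum.elim (fun p => ⟨D p, Or.inl p.1.mem⟩) (fun p => ⟨(D p).symm, Or.inr p.1.mem⟩)
  have hDinj : Function.Injective D := by
    rintro ⟨x, i⟩ ⟨y, j⟩ h
    have h1 : x.1 = y.1 := congrArg (fun b : (latticeGraph d).Dart => b.fst) h
    have h2 : x.1 + unitVec i = y.1 + unitVec j :=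
      congrArg (fun b : (latticeGraph d).Dart => b.snd) h
    rw [h1] at h2
    exact Prod.ext (Subtype.ext h1) (unitVec_injective (add_left_cancel h2))
  have hDne : ∀ p q, D p ≠ (D q).symm := by
    intro p q h
    have h1 : p.1.1 = q.1.1 + unitVec q.2 :=
      congrArg (fun b : (latticeGraph d).Dart => b.fst) h
    have h2 := (latticeGraph_adj_parity (adj_add_unitVec q.1.1 q.2)).1 q.1.odd
    rw [← h1] at h2
    exact h2 p.1.odd
  have hDsurj : ∀ b : (latticeGraph d).Dart, Odd (∑ i, b.fst i) → b.fst ∈ assocSet Λ →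
      ∃ p, D p = b := by
    rintro ⟨⟨x, y⟩, hb⟩ h1 h2
    obtain ⟨i, hy⟩ := exists_unitVec_of_adj (x := x) (y := y) hb
    subst hy
    exact ⟨(⟨x, mem_oddSites.2 ⟨h2, h1⟩⟩, i), rfl⟩
  have hf : Function.Bijective f := by
    constructor
    · rintro (p | p) (q | q) h
      · exact congrArg _ (hDinj (congrArg Subtype.val h))
      · exact absurd (congrArg Subtype.val h) (hDne p q)
      · exact absurd (congrArg Subtype.val h).symm (hDne q p)
      · refine congrArg _ (hDinj ?_)
        have := congrArg Subtype.val h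
        exact SimpleGraph.Dart.symm_involutive.injective this
    · rintro ⟨b, hb⟩
      rcases (mem_closedBonds_assocSet_iff hΛ b).1 hb with ⟨h1, h2⟩ | ⟨h1, h2⟩
      · obtain ⟨p, hp⟩ := hDsurj b h1 h2
        exact ⟨Sum.inl p, Subtype.ext hp⟩
      · obtain ⟨p, hp⟩ := hDsurj b.symm h1 h2
        refine ⟨Sum.inr p, Subtype.ext ?_⟩
        change (D p).symm = b
        rw [hp, SimpleGraph.Dart.symm_symm]
  have hU' : ∀ p, U (η (D p).symm) = U (η (D p)) := fun p => by rw [hη (D p), hsymm]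
  have h1 : ∑ b : closedBonds (latticeGraph d) (assocSet Λ), U (η b) =
      ∑ p : (OddSite Λ × Dir d) ⊕ (OddSite Λ × Dir d), U (η (f p)) :=
    (Fintype.sum_bijective f hf _ _ fun _ => rfl).symm
  rw [pairEnergy, h1, Fintype.sum_sum_type]
  simp only [f, Sum.elim_inl, Sum.elim_inr, hU']
  rw [← two_mul, Fintype.sum_prod_type]
  simp only [siteEnergy, star, D]
  rw [← Finset.mul_sum]
  ring

/-- The integral over the height at an odd site. -/
theorem lintegral_siteEnergy (hU : Continuous U) {A B : ℝ} (hA : 0 < A)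
    (hgrowth : ∀ s, A * |s| ^ 2 - B ≤ U s) (hβ : 0 < β) (k : Dir d) (a : Dir d → ℝ) :
    Integrable (fun t : ℝ => Real.exp (-siteEnergy β U fun i => a i - t)) ∧
    ∫⁻ t : ℝ, ENNReal.ofReal (Real.exp (-siteEnergy β U fun i => a i - t)) =
      ENNReal.ofReal (Real.exp (-oddPotential β U a)) := by
  have hint : Integrable (fun t : ℝ => Real.exp (-siteEnergy β U fun i => a i - t)) := by
    -- A Gaussian majorant: of the quadratic lower bounds only that in direction `k` is kept, the
    -- other squares being nonnegative.
    have hg : Integrable fun t : ℝ =>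
        Real.exp (2 * β * (Fintype.card (Dir d) * B)) *
          Real.exp (-(2 * β * A) * (t - a k) ^ 2) :=
      ((integrable_exp_neg_mul_sq (by positivity)).comp_sub_right (a k)).const_mul _
    refine hg.mono' (Continuous.aestronglyMeasurable (by unfold siteEnergy; fun_prop))
      (Filter.Eventually.of_forall fun t => ?_)
    rw [Real.norm_of_nonneg (Real.exp_pos _).le, ← Real.exp_add]
    refine Real.exp_le_exp.2 ?_
    have h1 : A * (t - a k) ^ 2 - Fintype.card (Dir d) * B ≤ ∑ i, U (a i - t) := by
      calc A * (t - a k) ^ 2 - Fintype.card (Dir d) * B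
          ≤ ∑ i, A * |a i - t| ^ 2 - Fintype.card (Dir d) * B := by
            have := Finset.single_le_sum (f := fun i => A * |a i - t| ^ 2)
              (fun i _ => by positivity) (Finset.mem_univ k)
            simp only [sq_abs] at this ⊢
            have e : (t - a k) ^ 2 = (a k - t) ^ 2 := by ring
            rw [e]; linarith
        _ = ∑ i, (A * |a i - t| ^ 2 - B) := by
            rw [Finset.sum_sub_distrib]; simp
        _ ≤ _ := Finset.sum_le_sum fun i _ => hgrowth _
    unfold siteEnergy
    nlinarith [mul_le_mul_of_nonneg_left h1 (by positivity : 0 ≤ 2 * β)]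
  have e : oddPotential β U a =
      -Real.log (∫ t : ℝ, Real.exp (-siteEnergy β U fun i => a i - t)) := rfl
  refine ⟨hint, ?_⟩
  rw [← ofReal_integral_eq_lintegral_ofReal hint
    (Filter.Eventually.of_forall fun t => (Real.exp_pos _).le), e, neg_neg,
    Real.exp_log (integral_exp_pos hint)]

/-- The differences from `x` and the even differences from `x + e_k` differ by the constant `η(x, x
+ e_k)`, which a translation of `t` absorbs. This is why the choice of `k` is immaterial. -/
theorem lintegral_siteEnergy_shift (hU : Continuous U) {A B : ℝ} (hA : 0 < A)
    (hgrowth : ∀ s, A * |s| ^ 2 - B ≤ U s) (hβ : 0 < β) (k : Dir d) {η : (latticeGraph d).Dart → ℝ}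
    (hη : η ∈ plaquetteFields (latticeGraph d) {4}) {x : Site d} (hx : Odd (∑ i, x i)) :
    Integrable (fun t : ℝ => Real.exp (-siteEnergy β U fun i => star η x i - t)) ∧
    ∫⁻ t : ℝ, ENNReal.ofReal (Real.exp (-siteEnergy β U fun i => star η x i - t)) =
      ENNReal.ofReal (Real.exp (-oddPotential β U fun i =>
        evenValue (evenField η) (x + unitVec k) (x + unitVec i))) := by
  refine ⟨(lintegral_siteEnergy hU hA hgrowth hβ k (star η x)).1, ?_⟩
  have h : ∀ i, star η x i =
      evenValue (evenField η) (x + unitVec k) (x + unitVec i) + star η x k := by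
    intro i
    by_cases hi : i = k
    · subst hi; rw [evenValue_self, zero_add]
    · have hadj := evenGraph_adj_of_adj hx (adj_add_unitVec x k) (adj_add_unitVec x i)
        (fun h => hi (unitVec_injective (add_left_cancel h)).symm)
      rw [evenValue_of_adj _ hadj, evenField_eq hη ⟨(x + unitVec k, x + unitVec i), hadj⟩ x
        (adj_add_unitVec x k).symm (adj_add_unitVec x i),
        hη.1 ⟨(x + unitVec k, x), (adj_add_unitVec x k).symm⟩]
      simp [star, SimpleGraph.Dart.symm]
  rw [← (lintegral_siteEnergy hU hA hgrowth hβ k _).2, ← lintegral_add_right_eq_self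
    (fun t : ℝ => ENNReal.ofReal (Real.exp (-siteEnergy β U fun i => star η x i - t)))
    (star η x k)]
  refine lintegral_congr fun t => ?_
  congr 4
  funext i
  rw [h i]; ring

theorem lintegral_fintype_prod {ι : Type*} [Fintype ι] {f : ι → ℝ → ℝ}
    (hf : ∀ i, Integrable (f i)) (h0 : ∀ i t, 0 ≤ f i t) :
    ∫⁻ c : ι → ℝ, ENNReal.ofReal (∏ i, f i (c i)) = ∏ i, ∫⁻ t, ENNReal.ofReal (f i t) := by
  have h1 : Integrable (fun c : ι → ℝ => ∏ i, f i (c i)) :=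
    Integrable.fintype_prod_dep (μ := fun _ => volume) hf
  rw [← ofReal_integral_eq_lintegral_ofReal h1
    (Filter.Eventually.of_forall fun c => Finset.prod_nonneg fun i _ => h0 i _),
    integral_fintype_prod_volume_eq_prod,
    ENNReal.ofReal_prod_of_nonneg fun i _ => integral_nonneg (h0 i)]
  exact Finset.prod_congr rfl fun i _ => ofReal_integral_eq_lintegral_ofReal (hf i)
    (Filter.Eventually.of_forall (h0 i))

/-- Integrating out the heights at the odd sites turns the Boltzmann factor of `H` into that of
the even Hamiltonian. -/
theorem lintegral_boltzmann_oddHeight (hU : Continuous U) (hsymm : ∀ s, U (-s) = U s) {A B : ℝ}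
    (hA : 0 < A) (hgrowth : ∀ s, A * |s| ^ 2 - B ≤ U s) (hβ : 0 < β) (k : Dir d)
    {Λ : Finset (Site d)} (hΛ : (Λ : Set (Site d)) ⊆ evenSites d) {η : (latticeGraph d).Dart → ℝ}
    (hη : η ∈ plaquetteFields (latticeGraph d) {4}) :
    ∫⁻ c : OddSite Λ → ℝ, boltzmann (pairEnergy β U) (assocSet Λ)
      (η + grad (latticeGraph d) (oddHeight (oddExtend Λ c))) =
      boltzmann (evenEnergy β U k) Λ (evenField η) := by
  -- All neighbours of `x` are even and do not move, so the star at `x` feels only `c x` and the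
  -- Boltzmann factor is a product over odd sites.
  have hstar : ∀ (c : OddSite Λ → ℝ) (x : OddSite Λ),
      star (η + grad (latticeGraph d) (oddHeight (oddExtend Λ c))) x =
        fun i => star η x i - c x := by
    intro c x
    funext i
    have hx : Odd (∑ i, x.1 i) := x.odd
    have hy := (latticeGraph_adj_parity (adj_add_unitVec x.1 i)).1 hx
    have h1 : oddHeight (oddExtend Λ c) x.1 = c x := by
      rw [oddHeight, if_pos hx, oddExtend_apply]
    have h2 : oddHeight (oddExtend Λ c) (x.1 + unitVec i) = 0 := by rw [oddHeight, if_neg hy]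
    change star η x i + (oddHeight (oddExtend Λ c) (x.1 + unitVec i) -
      oddHeight (oddExtend Λ c) x.1) = _
    rw [h1, h2]
    ring
  have h1 : ∀ c : OddSite Λ → ℝ, boltzmann (pairEnergy β U) (assocSet Λ)
      (η + grad (latticeGraph d) (oddHeight (oddExtend Λ c))) =
      ENNReal.ofReal (∏ x : OddSite Λ, Real.exp (-siteEnergy β U fun i => star η x i - c x)) := by
    intro c
    rw [boltzmann, pairEnergy_eq_sum hsymm hΛ
      (add_mem hη (grad_mem_plaquetteFields (latticeGraph d) {4} _)).1, ← Finset.sum_neg_distrib,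
      Real.exp_sum]
    simp only [hstar]
  have h2 := fun x : OddSite Λ => lintegral_siteEnergy_shift hU hA hgrowth hβ k hη x.odd
  simp only [h1]
  rw [lintegral_fintype_prod (f := fun (x : OddSite Λ) t =>
    Real.exp (-siteEnergy β U fun i => star η x i - t)) (fun x => (h2 x).1)
    fun _ _ => (Real.exp_pos _).le]
  rw [Finset.prod_congr rfl fun x _ => (h2 x).2, boltzmann, evenEnergy, ← Finset.sum_neg_distrib,
    Real.exp_sum, ENNReal.ofReal_prod_of_nonneg fun _ _ => (Real.exp_pos _).le]
  exact Finset.prod_coe_sort (oddSites Λ) fun x =>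
    ENNReal.ofReal (Real.exp (-oddPotential β U fun i =>
      evenValue (evenField η) (x + unitVec k) (x + unitVec i)))

/-- The partition function of the even model, as an integral over the even directions and the
heights on the odd sites. -/
theorem lintegral_boltzmann_fiberField (hU : Continuous U) (hsymm : ∀ s, U (-s) = U s) {A B : ℝ}
    (hA : 0 < A) (hgrowth : ∀ s, A * |s| ^ 2 - B ≤ U s) (hβ : 0 < β) (k : Dir d)
    {Λ : Finset (Site d)} (hΛ : (Λ : Set (Site d)) ⊆ evenSites d) {η : (latticeGraph d).Dart → ℝ}
    (hη : η ∈ plaquetteFields (latticeGraph d) {4}) {f : ((evenGraph d).Dart → ℝ) → ℝ≥0∞}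
    (hf : Measurable f) :
    ∫⁻ w, boltzmann (pairEnergy β U) (assocSet Λ) (η + fiberField k Λ w) *
        f (evenField (η + fiberField k Λ w)) ∂(lebDir (evenGraph d) {3, 4} Λ).prod volume =
      dirIntegral {3, 4} Λ (fun ξ => boltzmann (evenEnergy β U k) Λ ξ * f ξ) (evenField η) := by
  have hT := (continuous_fiberField k Λ).measurable
  have hb := measurable_boltzmann (measurable_pairEnergy hU β (assocSet Λ))
  have he := measurable_evenField (d := d)
  rw [lintegral_prod _ (by fun_prop), dirIntegral]
  refine lintegral_congr fun v => ?_
  simp only [evenField_add, evenField_fiberField]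
  -- The lifted even direction joins the background field; `f` no longer depends on the odd heights
  -- and leaves the inner integral.
  have hη' := add_mem hη (liftField_mem_plaquetteFields k (extend_mem (Λ := Λ) v))
  rw [lintegral_mul_const _ (by fun_prop)]
  congr 1
  have := lintegral_boltzmann_oddHeight hU hsymm hA hgrowth hβ k hΛ hη'
  rw [evenField_add, evenField_liftField k (extend_mem v)] at this
  rw [← this]
  refine lintegral_congr fun c => ?_
  rw [add_assoc]
  rfl

/-- Compare with `(1 + ‖x‖)^(-n)` for `n` above the dimension, using `y^n / n! ≤ exp y` at `y = c (1
+ ‖x‖)`. -/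
theorem integrable_exp_neg_mul_norm {V : Type*} [NormedAddCommGroup V] [NormedSpace ℝ V]
    [FiniteDimensional ℝ V] [MeasurableSpace V] [BorelSpace V] (ν : Measure V)
    [ν.IsAddHaarMeasure] {c : ℝ} (hc : 0 < c) : Integrable (fun x => Real.exp (-(c * ‖x‖))) ν := by
  set n := Module.finrank ℝ V + 1 with hn
  have h1 : Integrable (fun x : V => (1 + ‖x‖) ^ (-(n : ℝ))) ν :=
    integrable_one_add_norm (by rw [hn]; push_cast; linarith)
  refine (h1.const_mul (Real.exp c * n.factorial / c ^ n)).mono'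
    (Continuous.aestronglyMeasurable (by fun_prop)) (Filter.Eventually.of_forall fun x => ?_)
  have hx : 0 < 1 + ‖x‖ := by positivity
  rw [Real.norm_of_nonneg (Real.exp_pos _).le, Real.rpow_neg hx.le, Real.rpow_natCast]
  have h2 := Real.pow_div_factorial_le_exp (x := c * (1 + ‖x‖)) (by positivity) n
  have h3 : Real.exp (-(c * ‖x‖)) = Real.exp c * (Real.exp (c * (1 + ‖x‖)))⁻¹ := by
    rw [← Real.exp_neg, ← Real.exp_add]; congr 1; ring
  have h4 : (Real.exp (c * (1 + ‖x‖)))⁻¹ ≤ ((c * (1 + ‖x‖)) ^ n / n.factorial)⁻¹ :=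
    inv_anti₀ (by positivity) h2
  calc _ ≤ Real.exp c * ((c * (1 + ‖x‖)) ^ n / n.factorial)⁻¹ := by
        rw [h3]; gcongr
    _ = _ := by rw [mul_pow]; field_simp

/-- An injective linear map on a finite-dimensional space is bounded below, so the energy grows at
least linearly in `‖w‖`; this already makes the Boltzmann factor integrable. -/
theorem lintegral_boltzmann_fiberField_ne_top {A B : ℝ} (hA : 0 < A)
    (hgrowth : ∀ s, A * |s| ^ 2 - B ≤ U s) (hβ : 0 < β) (k : Dir d) (Λ : Finset (Site d))
    (η : (latticeGraph d).Dart → ℝ) :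
    ∫⁻ w, boltzmann (pairEnergy β U) (assocSet Λ) (η + fiberField k Λ w)
      ∂(lebDir (evenGraph d) {3, 4} Λ).prod volume ≠ ∞ := by
  let C := closedBonds (latticeGraph d) (assocSet Λ)
  let R : FiberSpace Λ →ₗ[ℝ] (C → ℝ) :=
    (LinearMap.funLeft ℝ ℝ (Subtype.val : C → _)).comp (fiberField k Λ)
  have hR : LinearMap.ker R = ⊥ := by
    rw [LinearMap.ker_eq_bot']
    intro w hw
    refine (injective_iff_map_eq_zero _).1 (fiberField_injective k Λ) w (funext fun b => ?_)
    by_cases hb : b ∈ C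
    · exact congrFun hw ⟨b, hb⟩
    · exact fiberField_eq_zero k Λ w b hb
  obtain ⟨K, hK, hanti⟩ := R.exists_antilipschitzWith hR
  let a : C → ℝ := fun b => η b
  have hK' : (0 : ℝ) < K := hK
  have hlow : ∀ w, ‖w‖ ≤ K * (‖a + R w‖ + ‖a‖) := by
    intro w
    have h1 := hanti.le_mul_dist w 0
    rw [map_zero, dist_zero_right, dist_zero_right] at h1
    have h2 : ‖R w‖ ≤ ‖a + R w‖ + ‖a‖ := by
      simpa using norm_sub_le (a + R w) a
    exact h1.trans (mul_le_mul_of_nonneg_left h2 hK'.le)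
  -- Sum `2|u_b| ≤ u_b² + 1` over the bonds, weakening quadratic growth to linear growth.
  have hsum : ∀ u : C → ℝ, 2 * ‖u‖ ≤ ∑ b, u b ^ 2 + Fintype.card C := by
    intro u
    have h1 : ‖u‖ ≤ ∑ b, |u b| := (pi_norm_le_iff_of_nonneg
      (Finset.sum_nonneg fun b _ => abs_nonneg _)).2 fun b =>
        Finset.single_le_sum (f := fun b => |u b|) (fun b _ => abs_nonneg _) (Finset.mem_univ b)
    have h2 : ∑ b, 2 * |u b| ≤ ∑ b, (u b ^ 2 + 1) := Finset.sum_le_sum fun b _ => by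
      nlinarith [sq_nonneg (|u b| - 1), sq_abs (u b)]
    rw [← Finset.mul_sum, Finset.sum_add_distrib] at h2
    simp only [Finset.sum_const, Finset.card_univ, nsmul_eq_mul, mul_one] at h2
    linarith
  set n : ℝ := ((Fintype.card C : ℕ) : ℝ)
  have hE : ∀ w, β * (A * (2 * (K : ℝ)⁻¹)) * ‖w‖ - β * (A * (2 * ‖a‖ + n) + n * B) ≤
      pairEnergy β U (assocSet Λ) (η + fiberField k Λ w) := by
    intro w
    have h1 : A * ∑ b, (a + R w) b ^ 2 - n * B ≤
        ∑ b : C, U ((η + fiberField k Λ w) b) := by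
      calc A * ∑ b, (a + R w) b ^ 2 - n * B = ∑ b : C, (A * |(a + R w) b| ^ 2 - B) := by
            rw [Finset.sum_sub_distrib, Finset.mul_sum]
            simp [n]
        _ ≤ _ := Finset.sum_le_sum fun b _ => hgrowth _
    have h2 : (K : ℝ)⁻¹ * ‖w‖ ≤ ‖a + R w‖ + ‖a‖ := by
      rw [inv_mul_le_iff₀ hK']
      exact hlow w
    have h3 := hsum (a + R w)
    have h4 : 2 * ((K : ℝ)⁻¹ * ‖w‖) - (2 * ‖a‖ + n) ≤ ∑ b, (a + R w) b ^ 2 := by linarith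
    have h5 := mul_le_mul_of_nonneg_left h4 hA.le
    have h6 := mul_le_mul_of_nonneg_left ((sub_le_sub_right h5 (n * B)).trans h1) hβ.le
    unfold pairEnergy
    refine le_trans (le_of_eq ?_) h6
    ring
  have hint := ((integrable_exp_neg_mul_norm ((lebDir (evenGraph d) {3, 4} Λ).prod
    (volume : Measure (OddSite Λ → ℝ))) (c := β * (A * (2 * (K : ℝ)⁻¹))) (by positivity)).const_mul
    (Real.exp (β * (A * (2 * ‖a‖ + n) + n * B)))).lintegral_lt_top
  refine ((lintegral_mono fun w => ?_).trans_lt hint).ne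
  refine ENNReal.ofReal_le_ofReal ?_
  rw [← Real.exp_add]
  refine Real.exp_le_exp.2 ?_
  linarith [hE w]

end Energy

/-! ### The DLR equation of the induced measure -/

section Induced

variable {d : ℕ} {U : ℝ → ℝ} {β : ℝ}

/-- A strictly positive function is integrated against a nonzero measure. -/
theorem dirIntegral_boltzmann_ne_zero {G : SimpleGraph (Site d)} [G.LocallyFinite] (N : Set ℕ)
    {E : Finset (Site d) → (G.Dart → ℝ) → ℝ} {Λ : Finset (Site d)} (hE : Measurable (E Λ))
    (ξ : G.Dart → ℝ) : dirIntegral N Λ (boltzmann E Λ) ξ ≠ 0 := by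
  have hm := (continuous_extend (G := G) N Λ).measurable
  have hb := measurable_boltzmann hE
  rw [dirIntegral, Ne, lintegral_eq_zero_iff (by fun_prop)]
  intro h
  obtain ⟨v, hv⟩ := h.exists
  exact boltzmann_ne_zero _ _ _ hv

/-- The integrated DLR equation of the induced measure. -/
theorem setLIntegral_finiteVolume_evenField (hU : Continuous U) (hsymm : ∀ s, U (-s) = U s)
    {A B : ℝ} (hA : 0 < A) (hgrowth : ∀ s, A * |s| ^ 2 - B ≤ U s) (hβ : 0 < β) (k : Dir d)
    {μ : Measure ((latticeGraph d).Dart → ℝ)}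
    (hμ : IsGradGibbs (latticeGraph d) Set.univ {4} (pairEnergy β U) μ) {Λ : Finset (Site d)}
    (hΛ : (Λ : Set (Site d)) ⊆ evenSites d) {D : Set ((evenGraph d).Dart → ℝ)}
    (hD : MeasurableSet D) {s : Set ((evenGraph d).Dart → ℝ)}
    (hs : MeasurableSet[outsideField (evenGraph d) Λ] s) :
    ∫⁻ ξ in s, finiteVolume (evenGraph d) {3, 4} (evenEnergy β U k) Λ ξ D ∂μ.map evenField =
      μ.map evenField (D ∩ s) := by
  have := hμ.prob
  have hs' := outsideField_le Λ s hs
  have he := measurable_evenField (d := d)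
  have hE := measurable_evenEnergy hU β k Λ
  have hP := measurable_pairEnergy hU β (assocSet Λ)
  have hb := measurable_boltzmann hP
  have hT := (continuous_fiberField k Λ).measurable
  let Z := dirIntegral {3, 4} Λ (boltzmann (evenEnergy β U k) Λ)
  have hZm : Measurable Z := measurable_dirIntegral {3, 4} Λ (measurable_boltzmann hE)
  -- The normalization `1/Z` is part of the invariant factor, since both `s` and `Z` are unaffected
  -- by even directions of `Λ`.
  let g₀ : ((evenGraph d).Dart → ℝ) → ℝ≥0∞ := fun ξ => s.indicator 1 ξ * (Z ξ)⁻¹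
  have hg₀ : Measurable g₀ := (measurable_one.indicator hs').mul hZm.inv
  let f₀ : ((evenGraph d).Dart → ℝ) → ℝ≥0∞ := D.indicator 1
  have hf₀ : Measurable f₀ := measurable_one.indicator hD
  have hg₀T : ∀ ξ v, g₀ (ξ + extend (evenGraph d) {3, 4} Λ v) = g₀ ξ := by
    intro ξ v
    have h1 : s.indicator (1 : ((evenGraph d).Dart → ℝ) → ℝ≥0∞) (ξ + extend (evenGraph d) {3, 4} Λ v) =
        s.indicator 1 ξ := by
      have h := mem_add_iff_of_outsideField hs (extend_apply_notMem v) ξ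
      by_cases h' : ξ ∈ s
      · rw [Set.indicator_of_mem h', Set.indicator_of_mem (h.2 h')]; rfl
      · rw [Set.indicator_of_notMem h', Set.indicator_of_notMem (mt h.1 h')]
    simp only [g₀, h1, Z, dirIntegral_add_extend]
  have hZ : ∀ η ∈ plaquetteFields (latticeGraph d) {4},
      ∫⁻ w, boltzmann (pairEnergy β U) (assocSet Λ) (η + fiberField k Λ w)
        ∂(lebDir (evenGraph d) {3, 4} Λ).prod volume = Z (evenField η) := fun η hη => by
    simpa using lintegral_boltzmann_fiberField hU hsymm hA hgrowth hβ k hΛ hη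
      (f := fun _ => 1) measurable_const
  have : ((lebDir (evenGraph d) {3, 4} Λ).prod (volume : Measure (OddSite Λ → ℝ))).Regular :=
    Measure.Regular.of_sigmaCompactSpace_of_isLocallyFiniteMeasure _
  have : ((lebDir (evenGraph d) {3, 4} Λ).prod
      (volume : Measure (OddSite Λ → ℝ))).IsNegInvariant :=
    Measure.IsAddHaarMeasure.isNegInvariant_of_regular _
  have orbit := lintegral_mul_lintegral_orbit μ ((lebDir (evenGraph d) {3, 4} Λ).prod volume)
    (fiberField k Λ).toAddMonoidHom hT hb (boltzmann_ne_zero _ _) (boltzmann_ne_top _ _)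
    (fun w P hPm => by
      obtain ⟨v, hv⟩ := exists_extend_eq_fiberField k Λ w
      have := hμ.lintegral_add_extend (Set.subset_univ _) hP hPm v
      rwa [hv] at this)
    (g := fun η => g₀ (evenField η)) (f := fun η => f₀ (evenField η)) (hg₀.comp he)
    (fun η w => by
      change g₀ (evenField (η + fiberField k Λ w)) = _
      rw [evenField_add, evenField_fiberField, hg₀T])
    (hf₀.comp he)
  calc _ = ∫⁻ ξ, g₀ ξ * dirIntegral {3, 4} Λ (fun ξ => boltzmann (evenEnergy β U k) Λ ξ * f₀ ξ) ξ
        ∂μ.map evenField := by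
        rw [← lintegral_indicator hs']
        refine lintegral_congr fun ξ => ?_
        by_cases h : ξ ∈ s
        · simp only [h, Set.indicator_of_mem, finiteVolume_apply {3, 4} hE hD, g₀, Pi.one_apply,
            one_mul]
          rfl
        · simp [h, g₀]
    _ = ∫⁻ η, g₀ (evenField η) * dirIntegral {3, 4} Λ
          (fun ξ => boltzmann (evenEnergy β U k) Λ ξ * f₀ ξ) (evenField η) ∂μ :=
        lintegral_map (hg₀.mul (measurable_dirIntegral _ _ ((measurable_boltzmann hE).mul hf₀))) he
    _ = ∫⁻ η, g₀ (evenField η) * ∫⁻ w, boltzmann (pairEnergy β U) (assocSet Λ)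
          (η + fiberField k Λ w) * f₀ (evenField (η + fiberField k Λ w))
          ∂(lebDir (evenGraph d) {3, 4} Λ).prod volume ∂μ := by
        refine lintegral_congr_ae ?_
        filter_upwards [hμ.carried] with η hη
        rw [lintegral_boltzmann_fiberField hU hsymm hA hgrowth hβ k hΛ hη hf₀]
    _ = ∫⁻ η, g₀ (evenField η) * f₀ (evenField η) * ∫⁻ w, boltzmann (pairEnergy β U) (assocSet Λ)
          (η + fiberField k Λ w) ∂(lebDir (evenGraph d) {3, 4} Λ).prod volume ∂μ := orbit
    _ = ∫⁻ η, (D ∩ s).indicator 1 (evenField η) ∂μ := by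
        refine lintegral_congr_ae ?_
        filter_upwards [hμ.carried] with η hη
        have h1 : Z (evenField η) ≠ ∞ := by
          rw [← hZ η hη]
          exact lintegral_boltzmann_fiberField_ne_top hA hgrowth hβ k Λ η
        have h0 : Z (evenField η) ≠ 0 := dirIntegral_boltzmann_ne_zero _ hE _
        -- The orbit integral of the Boltzmann factor is the even partition function and cancels its
        -- inverse in `g₀`.
        rw [hZ η hη, mul_right_comm, mul_assoc _ _ (Z _), ENNReal.inv_mul_cancel h0 h1, mul_one]
        by_cases hd : evenField η ∈ D <;> by_cases hs : evenField η ∈ s <;> simp [f₀, hd, hs]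
    _ = ∫⁻ ξ, (D ∩ s).indicator 1 ξ ∂μ.map evenField :=
        (lintegral_map (measurable_one.indicator (hD.inter hs')) he).symm
    _ = _ := lintegral_indicator_one (hD.inter hs')

end Induced

end GradGibbs

end

/-! ### The induced measure is Gibbs for the even Hamiltonian -/

theorem lemma3p2 (d : ℕ) (U : ℝ → ℝ) (hU : ContDiff ℝ 2 U) (hsymm : ∀ s, U (-s) = U s)
    (A B : ℝ) (hA : 0 < A) (hgrowth : ∀ s, A * |s| ^ 2 - B ≤ U s) (β : ℝ) (hβ : 0 < β)
    (k : GradGibbs.Dir d) (μ : MeasureTheory.Measure ((GradGibbs.latticeGraph d).Dart → ℝ))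
    (hμ : μ ∈ GradGibbs.gibbsClass (GradGibbs.latticeGraph d) Set.univ {4}
      (GradGibbs.pairEnergy β U)) :
    μ.map GradGibbs.evenField ∈ GradGibbs.gibbsClass (GradGibbs.evenGraph d)
      (GradGibbs.evenSites d) {3, 4} (GradGibbs.evenEnergy β U k) := by
  obtain ⟨hG, hint⟩ := hμ
  have hprob := hG.prob
  have he := GradGibbs.measurable_evenField (d := d)
  have hprob' := Measure.isProbabilityMeasure_map (μ := μ) he.aemeasurable
  have hc : ∀ᵐ ξ ∂μ.map GradGibbs.evenField,
      ξ ∈ GradGibbs.plaquetteFields (GradGibbs.evenGraph d) {3, 4} := by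
    refine (ae_map_iff he.aemeasurable
      (GradGibbs.isClosed_plaquetteFields {3, 4}).measurableSet).2 ?_
    filter_upwards [hG.carried] with η hη using GradGibbs.evenField_mem_plaquetteFields hη _
  refine ⟨⟨hprob', hc, fun Λ hΛ D hD => ?_⟩, fun b => ?_⟩
  · exact GradGibbs.condExp_eq_finiteVolume hc
      (GradGibbs.measurable_evenEnergy hU.continuous β k Λ) hD fun s hs =>
        GradGibbs.setLIntegral_finiteVolume_evenField hU.continuous hsymm hA hgrowth hβ k hG hΛ hD hs
  -- An even difference is a sum of two square integrable differences.
  · have hsq : ∀ b', MemLp (fun η : (GradGibbs.latticeGraph d).Dart → ℝ => η b') 2 μ := fun b' =>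
      (memLp_two_iff_integrable_sq (measurable_pi_apply b').aestronglyMeasurable).2 (hint b')
    rw [integrable_map_measure ((measurable_pi_apply b).pow_const 2).aestronglyMeasurable
      he.aemeasurable]
    exact (memLp_two_iff_integrable_sq (((measurable_pi_apply b).comp he).aestronglyMeasurable)).1
      ((hsq _).add (hsq _))
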